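/- For an integer $n\ge 2$ and a complex number $\beta$ with $|\beta|\le 1$, let $S(n,\beta)$ be the set of complex polynomials of degree $n$ all of whose roots lie in the closed unit disk and which have at least one root at $\beta$. For a polynomial $P\in S(n,\beta)$ let $|P|_\beta$ be the distance between $\beta$ and the closest root of the derivative $P'$, and let $r_n(\beta)=\sup\{|P|_\beta : P\in S(n,\beta)\}$. There exist real constants $K_n>0$ ($n\ge 1$) with $\lim_{n\to\infty}K_n=1/3$ such that for every $n\ge 1$ \[ r_{n+1}(\beta)=1-K_n(1-\beta)+O\big((1-\beta)^2\big)\qquad\text{as }\beta\to 1,\ \beta\in[0,1], \] where the implied constant may depend on $n$. Consequently the constant $1/3$ is the best possible in linear upper bounds of the form $1-c(1-\beta)$ valid for large $n$: for every real $c>1/3$ and all sufficiently large $n$ (depending on $c$), $r_{n+1}(\beta)>1-c(1-\beta)$ for all real $\beta<1$ sufficiently close to $1$ (depending on $c$ and $n$). -/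

import Mathlib

open Filter Topology Polynomial Asymptotics

/-- `S(n, β)`: complex polynomials of degree `n` with all roots in the closed unit disk and
at least one root at `β`. -/
def sendovClass (n : ℕ) (β : ℂ) : Set ℂ[X] :=
  {P | P.degree = n ∧ (∀ z : ℂ, P.IsRoot z → ‖z‖ ≤ 1) ∧ P.IsRoot β}

/-- `|P|_β`: the distance between `β` and the closest root of the derivative of `P`. -/
noncomputable def criticalDist (P : ℂ[X]) (β : ℂ) : ℝ :=
  Metric.infDist β {ζ : ℂ | P.derivative.IsRoot ζ}

/-- `r_n(β)`: the supremum of `|P|_β` over `P ∈ S(n, β)`. -/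
noncomputable def sendovRadius (n : ℕ) (β : ℂ) : ℝ :=
  sSup ((fun P : ℂ[X] => criticalDist P β) '' sendovClass n β)

/-! Write `β = 1 - ε` with `ε = r ^ 2`, and take the critical points `ζ j` as parameters.
Integrating `P'` from `β` shows that the roots solve `x ^ (n+1) = β ^ (n+1) - (terms linear in the
coefficients of ∏ (X - ζ j))`. Competitors with `|P|_β < 1 - ε` are irrelevant, since the claimed
value is at least `1 - ε`. For the others, comparing `P''/P'` at `β` with the location of the roots
(`CritConfig.crit_bound`) forces `Re ζ j = O(ε)` and `Im ζ j = O(√ε)`, so the roots other than `β`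
lie near the roots of unity `ω ≠ 1`.

Put `A = -∑ Re ζ j` and `w = ∑ (Im ζ j)² / 2`. Averaging the condition `|z| ≤ 1` over the roots near
`ω` and near its conjugate leaves, up to `O(ε²)`, the linear inequality `A (1 - Re ω)/n + w (1 - Re
ω²)/(n-1) ≤ ε`. On the other side `|β - ζ j| = 1 - ε - Re ζ j + (Im ζ j)²/2 + O(ε²)`, so the
smallest of these distances is at most their mean `1 - ε + (A + w)/n + O(ε²)`. To first order the
problem is therefore to maximise `A + w` over a linear program, which gives the upper bound
(`upper_asymptotics`). Conversely, an optimal `(A, w)` is realised by one conjugate pair of critical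
points and one multiple real critical point, all at about the same distance from `β`; shrinking the
scale from `ε` to `ε - C ε²` pays for the errors (`roots_in_disk`, `lower_configurations`). Hence
`K_n = 1 - lpValue n / n` for `n ≥ 2`.

Finally `lpValue n / n → 2/3`: asymptotically the binding constraint is the one at a primitive cube
root of unity (`le_lpValue_div`, `lpValue_div_le`). -/

/-! ### The linear program and the limit of its value -/

/-- Feasibility for the linear program, with right-hand side `s`, whose value governs the first
order behaviour of the Sendov radius. -/
def Feasible (n : ℕ) (s A w : ℝ) : Prop :=
  0 ≤ w ∧ ∀ ω : ℂ, ω ^ (n + 1) = 1 →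
    A * (1 - ω.re) / n + w * (1 - (ω ^ 2).re) / ((n : ℝ) - 1) ≤ s

/-- The value of the linear program `Feasible n 1`. -/
noncomputable def lpValue (n : ℕ) : ℝ :=
  sSup {x | ∃ A w, Feasible n 1 A w ∧ A + w = x}

theorem re_sq_of_pow_eq_one {n : ℕ} {ω : ℂ} (h : ω ^ (n + 1) = 1) :
    (ω ^ 2).re = 2 * ω.re ^ 2 - 1 := by
  have h1 : ‖ω‖ = 1 := Complex.norm_eq_one_of_pow_eq_one h (Nat.succ_ne_zero n)
  have h2 : ω.re ^ 2 + ω.im ^ 2 = 1 := by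
    have := Complex.sq_norm ω
    rw [h1, Complex.normSq_apply] at this
    nlinarith
  rw [pow_two, Complex.mul_re]
  nlinarith

/-- Sum the constraints over all roots of unity: both `ω` and `ω ^ 2` sum to zero (the latter
because `n + 1 > 2`), and `ω = 1` contributes nothing, so only `n` copies of `s` appear. This bounds
the feasible region. -/
theorem Feasible.sum_le {n : ℕ} (hn : 2 ≤ n) {s A w : ℝ} (h : Feasible n s A w) :
    A * (n + 1) / n + w * (n + 1) / ((n : ℝ) - 1) ≤ n * s := by
  have hprim := Complex.isPrimitiveRoot_exp (n + 1) (Nat.succ_ne_zero n)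
  set ξ : ℂ := Complex.exp (2 * Real.pi * Complex.I / ((n + 1 : ℕ) : ℂ)) with hξ
  have hs1 : ∑ j ∈ Finset.range (n + 1), ξ ^ j = 0 := hprim.geom_sum_eq_zero (by omega)
  have hs2 : ∑ j ∈ Finset.range (n + 1), (ξ ^ 2) ^ j = 0 := by
    have hne : ξ ^ 2 ≠ 1 := hprim.pow_ne_one_of_pos_of_lt (by norm_num) (by omega)
    have := mul_geom_sum (ξ ^ 2) (n + 1)
    rw [← pow_mul, mul_comm 2, pow_mul, hprim.pow_eq_one, one_pow, sub_self] at this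
    exact (mul_eq_zero.1 this).resolve_left (sub_ne_zero.2 hne)
  have hr1 : ∑ j ∈ Finset.range (n + 1), (ξ ^ j).re = 0 := by
    rw [← Complex.re_sum, hs1, Complex.zero_re]
  have hr2 : ∑ j ∈ Finset.range (n + 1), ((ξ ^ j) ^ 2).re = 0 := by
    rw [← Complex.re_sum, Finset.sum_congr rfl (fun j _ => by rw [← pow_mul, mul_comm, pow_mul]),
      hs2, Complex.zero_re]
  have key : ∑ j ∈ Finset.range (n + 1),
      (A * (1 - (ξ ^ j).re) / n + w * (1 - ((ξ ^ j) ^ 2).re) / ((n : ℝ) - 1)) ≤ n * s := by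
    rw [Finset.sum_range_succ']
    have : ∑ j ∈ Finset.range n, (A * (1 - (ξ ^ (j + 1)).re) / n +
        w * (1 - ((ξ ^ (j + 1)) ^ 2).re) / ((n : ℝ) - 1)) ≤ ∑ j ∈ Finset.range n, s := by
      refine Finset.sum_le_sum fun j _ => h.2 _ ?_
      rw [← pow_mul, mul_comm, pow_mul, hprim.pow_eq_one, one_pow]
    simpa using this
  have e : ∑ j ∈ Finset.range (n + 1),
      (A * (1 - (ξ ^ j).re) / n + w * (1 - ((ξ ^ j) ^ 2).re) / ((n : ℝ) - 1))
      = A * (n + 1) / n + w * (n + 1) / ((n : ℝ) - 1) := by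
    rw [Finset.sum_add_distrib, ← Finset.sum_div, ← Finset.sum_div, ← Finset.mul_sum,
      ← Finset.mul_sum, Finset.sum_sub_distrib, Finset.sum_sub_distrib, hr1, hr2]
    simp
  rwa [e] at key

theorem Feasible.add_le {n : ℕ} (hn : 2 ≤ n) {s A w : ℝ} (h : Feasible n s A w) :
    A + w * (n / ((n : ℝ) - 1)) ≤ n ^ 2 / (n + 1) * s := by
  have h1 := h.sum_le hn
  have hn' : (2 : ℝ) ≤ n := by exact_mod_cast hn
  have h0 : (0 : ℝ) < (n : ℝ) / (n + 1) := by positivity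
  have := mul_le_mul_of_nonneg_left h1 h0.le
  have h3 : (n : ℝ) - 1 ≠ 0 := by linarith
  calc _ = (n : ℝ) / (n + 1) * (A * (n + 1) / n + w * (n + 1) / ((n : ℝ) - 1)) := by
        field_simp
    _ ≤ _ := this
    _ = _ := by ring

theorem Feasible.add_le' {n : ℕ} (hn : 2 ≤ n) {s A w : ℝ} (h : Feasible n s A w) :
    A + w ≤ n ^ 2 / (n + 1) * s := by
  refine le_trans ?_ (h.add_le hn)
  have hn' : (2 : ℝ) ≤ n := by exact_mod_cast hn
  have : 1 ≤ (n : ℝ) / ((n : ℝ) - 1) := by rw [le_div_iff₀] <;> linarith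
  nlinarith [h.1]

theorem feasible_zero (n : ℕ) : Feasible n 1 0 0 := ⟨le_rfl, fun ω _ => by simp⟩

/-- The part of the feasible region with `A + w ≥ 0` is compact and contains the origin, so an
optimal pair exists; the lower bound for the Sendov radius is built from it. -/
theorem isGreatest_lpValue {n : ℕ} (hn : 2 ≤ n) :
    IsGreatest {x | ∃ A w, Feasible n 1 A w ∧ A + w = x} (lpValue n) := by
  have hn' : (2 : ℝ) ≤ n := by exact_mod_cast hn
  have h3 : (0 : ℝ) < (n : ℝ) - 1 := by linarith
  let S : Set (ℝ × ℝ) := {p | Feasible n 1 p.1 p.2 ∧ 0 ≤ p.1 + p.2}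
  have hclosed : IsClosed S := by
    have : S = {p | 0 ≤ p.2} ∩ (⋂ ω ∈ {ω : ℂ | ω ^ (n + 1) = 1}, {p : ℝ × ℝ |
        p.1 * (1 - ω.re) / n + p.2 * (1 - (ω ^ 2).re) / ((n : ℝ) - 1) ≤ 1}) ∩
        {p | 0 ≤ p.1 + p.2} := by
      ext p
      simp [S, Feasible]
    rw [this]
    refine (IsClosed.inter (isClosed_le (by fun_prop) (by fun_prop)) ?_).inter
      (isClosed_le (by fun_prop) (by fun_prop))
    exact isClosed_biInter fun ω _ => isClosed_le (by fun_prop) (by fun_prop)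
  have hsub : S ⊆ Set.Icc (-((n : ℝ) * n)) (n * n) ×ˢ Set.Icc 0 ((n : ℝ) * n) := by
    rintro ⟨A, w⟩ ⟨hf, h0⟩
    have h1 := hf.add_le hn
    have hw := hf.1
    have e : w * (n / ((n : ℝ) - 1)) = w + w / (n - 1) := by field_simp; ring
    have h4 : (n : ℝ) ^ 2 / (n + 1) * 1 ≤ n := by
      rw [mul_one, div_le_iff₀ (by positivity)]; nlinarith
    simp only at h0 hw
    -- Subtracting `A + w ≥ 0` from the summed constraint isolates `w / (n - 1)`, which bounds `w`
    -- and then `A`.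
    have h5 : w / (n - 1) ≤ n := by linarith
    rw [div_le_iff₀ h3] at h5
    have h6 := div_nonneg hw h3.le
    refine ⟨⟨?_, ?_⟩, hw, ?_⟩ <;> simp only <;> nlinarith
  have hcomp : IsCompact S := (isCompact_Icc.prod isCompact_Icc).of_isClosed_subset hclosed hsub
  obtain ⟨p, hp, hmax⟩ := hcomp.exists_isMaxOn
    ⟨(0, 0), feasible_zero n, by simp⟩
    (f := fun p : ℝ × ℝ => p.1 + p.2) (by fun_prop)
  have hg : IsGreatest {x | ∃ A w, Feasible n 1 A w ∧ A + w = x} (p.1 + p.2) := by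
    refine ⟨⟨p.1, p.2, hp.1, rfl⟩, ?_⟩
    rintro x ⟨A, w, hf, rfl⟩
    by_cases h0 : 0 ≤ A + w
    · exact hmax (show (A, w) ∈ S from ⟨hf, h0⟩)
    · exact (not_le.1 h0).le.trans hp.2
  rw [lpValue, hg.csSup_eq]
  exact hg

/-- The program is homogeneous in `s`. For `s = 0` no rescaling is possible and the summed
constraint is used instead. -/
theorem Feasible.le_lpValue {n : ℕ} (hn : 2 ≤ n) {s A w : ℝ} (h : Feasible n s A w)
    (hs : 0 ≤ s) : A + w ≤ lpValue n * s := by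
  rcases hs.eq_or_lt with rfl | hs
  · simpa using h.add_le' hn
  have : Feasible n 1 (A / s) (w / s) := by
    refine ⟨div_nonneg h.1 hs.le, fun ω hω => ?_⟩
    have := h.2 ω hω
    rw [← div_le_one hs] at this
    refine le_trans (le_of_eq ?_) this
    ring
  have := (isGreatest_lpValue hn).2 ⟨_, _, this, rfl⟩
  rwa [← add_div, div_le_iff₀ hs] at this

theorem lpValue_nonneg {n : ℕ} (hn : 2 ≤ n) : 0 ≤ lpValue n := by
  simpa using (feasible_zero n).le_lpValue hn zero_le_one

theorem lpValue_lt {n : ℕ} (hn : 2 ≤ n) : lpValue n < n := by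
  obtain ⟨A, w, h, e⟩ := (isGreatest_lpValue hn).1
  have h1 := h.add_le' hn
  rw [e] at h1
  refine h1.trans_lt ?_
  have : (2 : ℝ) ≤ n := by exact_mod_cast hn
  rw [mul_one, div_lt_iff₀ (by positivity)]
  nlinarith

theorem le_lpValue_div {n : ℕ} (hn : 2 ≤ n) : 2 / 3 - 2 / 9 / (n : ℝ) ≤ lpValue n / n := by
  have hn' : (2 : ℝ) ≤ n := by exact_mod_cast hn
  have h3 : (0 : ℝ) < (n : ℝ) - 1 := by linarith
  -- With `c = Re ω` the left side of the constraint becomes `1 - (2c + 1)² / 9`: this choice has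
  -- its maximum, equal to `1`, exactly at `c = -1/2`.
  have hf : Feasible n 1 (4 / 9 * n) (2 / 9 * (n - 1)) := by
    refine ⟨by positivity, fun ω hω => ?_⟩
    rw [re_sq_of_pow_eq_one hω]
    have : 4 / 9 * (n : ℝ) * (1 - ω.re) / n +
        2 / 9 * ((n : ℝ) - 1) * (1 - (2 * ω.re ^ 2 - 1)) / ((n : ℝ) - 1)
        = 1 - (2 * ω.re + 1) ^ 2 / 9 := by
      field_simp; ring
    rw [this]
    nlinarith [sq_nonneg (2 * ω.re + 1)]
  have := hf.le_lpValue hn zero_le_one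
  rw [le_div_iff₀ (by positivity)]
  have e : (2 / 3 - 2 / 9 / (n : ℝ)) * n = 4 / 9 * n + 2 / 9 * (n - 1) := by field_simp; ring
  rw [e]; linarith

/-- A single constraint suffices, at the root of unity whose angle is `2π/3` rounded down. Rounding
down gives `c = Re ω ≥ -1/2`, hence `1 - Re ω² = 2(1 - c)(1 + c) ≥ 1 - c`, and the constraint
dominates `(A + w)(1 - c)/n`. -/
theorem lpValue_div_le {n : ℕ} (hn : 2 ≤ n) :
    lpValue n / n ≤ 1 / (1 - Real.cos (2 * Real.pi * (⌊(1 / 3 : ℝ) * ((n + 1 : ℕ) : ℝ)⌋₊ /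
      ((n + 1 : ℕ) : ℝ)))) := by
  have hn' : (2 : ℝ) ≤ n := by exact_mod_cast hn
  have h3 : (0 : ℝ) < (n : ℝ) - 1 := by linarith
  obtain ⟨A, w, h, e⟩ := (isGreatest_lpValue hn).1
  set j := ⌊(1 / 3 : ℝ) * ((n + 1 : ℕ) : ℝ)⌋₊ with hj
  set t : ℝ := (j : ℝ) / ((n + 1 : ℕ) : ℝ) with ht
  have hN : (0 : ℝ) < ((n + 1 : ℕ) : ℝ) := by positivity
  have hj1 : 1 ≤ j := by
    rw [hj, Nat.one_le_floor_iff]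
    push_cast; linarith
  have ht0 : 0 < t := div_pos (by exact_mod_cast hj1) hN
  have ht1 : t ≤ 1 / 3 := by
    rw [ht, div_le_iff₀ hN]
    exact Nat.floor_le (by positivity)
  have hpi := Real.pi_pos
  have hc : -(1 / 2) ≤ Real.cos (2 * Real.pi * t) := by
    have : Real.cos (2 * Real.pi / 3) = -(1 / 2) := by
      rw [show 2 * Real.pi / 3 = Real.pi - Real.pi / 3 by ring, Real.cos_pi_sub,
        Real.cos_pi_div_three]
    rw [← this]
    apply Real.cos_le_cos_of_nonneg_of_le_pi <;> nlinarith
  have hc1 : Real.cos (2 * Real.pi * t) < 1 := by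
    rw [← Real.cos_zero]
    apply Real.cos_lt_cos_of_nonneg_of_le_pi <;> nlinarith
  set ω : ℂ := Complex.exp ((2 * Real.pi * t : ℝ) * Complex.I) with hω
  have hωr : ω.re = Real.cos (2 * Real.pi * t) := Complex.exp_ofReal_mul_I_re _
  have hωN : ω ^ (n + 1) = 1 := by
    rw [hω, ← Complex.exp_nat_mul, Complex.exp_eq_one_iff]
    refine ⟨j, ?_⟩
    rw [ht]
    have : (((n + 1 : ℕ) : ℝ) : ℂ) ≠ 0 := by exact_mod_cast hN.ne'
    push_cast at this ⊢
    field_simp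
  have := h.2 ω hωN
  rw [re_sq_of_pow_eq_one hωN, hωr] at this
  set c := Real.cos (2 * Real.pi * t)
  rw [← e, le_div_iff₀ (by linarith), div_mul_eq_mul_div, div_le_iff₀ (by positivity)]
  have h5 : w * (1 - c) / n ≤ w * (1 - (2 * c ^ 2 - 1)) / (n - 1) := by
    have hw := h.1
    apply div_le_div₀ _ _ h3 (by linarith)
    · exact mul_nonneg hw (by nlinarith)
    · exact mul_le_mul_of_nonneg_left (by nlinarith) hw
  have h6 : A * (1 - c) / n + w * (1 - c) / n ≤ 1 := by linarith
  rw [← add_div, div_le_iff₀ (by positivity)] at h6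
  linarith

theorem tendsto_lpValue_div : Tendsto (fun n : ℕ => lpValue n / n) atTop (𝓝 (2 / 3)) := by
  have h1 : Tendsto (fun n : ℕ => 2 / 3 - 2 / 9 / (n : ℝ)) atTop (𝓝 (2 / 3)) := by
    simpa using (tendsto_const_div_atTop_nhds_zero_nat (2 / 9 : ℝ)).const_sub (2 / 3)
  have h2 : Tendsto (fun n : ℕ => 1 / (1 - Real.cos (2 * Real.pi *
      (⌊(1 / 3 : ℝ) * ((n + 1 : ℕ) : ℝ)⌋₊ / ((n + 1 : ℕ) : ℝ))))) atTop (𝓝 (2 / 3)) := by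
    have h := ((tendsto_nat_floor_mul_div_atTop (R := ℝ) (a := 1 / 3) (by norm_num)).comp
      tendsto_natCast_atTop_atTop).comp (tendsto_add_atTop_nat 1)
    have hc : Real.cos (2 * Real.pi * (1 / 3)) = -(1 / 2) := by
      rw [show 2 * Real.pi * (1 / 3) = Real.pi - Real.pi / 3 by ring, Real.cos_pi_sub,
        Real.cos_pi_div_three]
    have h' := ((Real.continuous_cos.tendsto _).comp (h.const_mul (2 * Real.pi))).const_sub 1
    rw [hc] at h'
    have := Tendsto.div (tendsto_const_nhds (x := (1 : ℝ))) h' (by norm_num)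
    norm_num at this
    simpa [Function.comp_def, Pi.div_def] using this
  refine tendsto_of_tendsto_of_tendsto_of_le_of_le' h1 h2 ?_ ?_
  · filter_upwards [eventually_ge_atTop 2] with n hn using le_lpValue_div hn
  · filter_upwards [eventually_ge_atTop 2] with n hn using lpValue_div_le hn

/-! ### Polynomials described by their roots and critical points -/

/-- `β` and the `z j` are the roots of a monic polynomial of degree `n + 1` whose critical points
are the `ζ j`. -/
def CritConfig (n : ℕ) (β : ℂ) (z ζ : Fin n → ℂ) : Prop :=
  derivative ((X - C β) * ∏ j, (X - C (z j))) = C ((n : ℂ) + 1) * ∏ j, (X - C (ζ j))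

theorem Multiset.exists_fin_map {α : Type*} {n : ℕ} (s : Multiset α) (h : Multiset.card s = n) :
    ∃ f : Fin n → α, s = Finset.univ.val.map f := by
  subst h
  refine ⟨fun j => s.toList.get (j.cast s.length_toList.symm), ?_⟩
  conv_lhs => rw [← s.coe_toList]
  rw [Fin.univ_val_map]
  congr 1
  apply List.ext_get <;> simp

theorem Polynomial.Monic.exists_fin_roots {n : ℕ} {p : ℂ[X]} (hp : p.Monic)
    (hd : p.natDegree = n) : ∃ f : Fin n → ℂ, p = ∏ j, (X - C (f j)) := by
  obtain ⟨f, hf⟩ := p.roots.exists_fin_map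
    ((splits_iff_card_roots.1 (IsAlgClosed.splits p)).trans hd)
  refine ⟨f, ?_⟩
  have := (IsAlgClosed.splits p).eq_prod_roots
  rw [hp.leadingCoeff, C_1, one_mul, hf, Multiset.map_map] at this
  exact this

theorem monic_prod_fin {n : ℕ} (z : Fin n → ℂ) : (∏ j, (X - C (z j))).Monic :=
  monic_prod_of_monic _ _ fun _ _ => monic_X_sub_C _

theorem natDegree_prod_fin {n : ℕ} (z : Fin n → ℂ) : (∏ j, (X - C (z j))).natDegree = n := by
  rw [natDegree_prod_of_monic _ _ fun _ _ => monic_X_sub_C _]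
  simp

theorem isRoot_prod_fin {n : ℕ} (z : Fin n → ℂ) (x : ℂ) :
    (∏ j, (X - C (z j))).IsRoot x ↔ ∃ j, x = z j := by
  simp [IsRoot, eval_prod, Finset.prod_eq_zero_iff, sub_eq_zero]

theorem exists_critConfig {n : ℕ} {β : ℂ} {P : ℂ[X]} (hP : P ∈ sendovClass (n + 1) β) :
    ∃ z ζ : Fin n → ℂ, CritConfig n β z ζ ∧ (∀ j, ‖z j‖ ≤ 1) ∧
      {x | P.derivative.IsRoot x} = Set.range ζ := by
  obtain ⟨hdeg, hroots, hβ⟩ := hP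
  have hP0 : P ≠ 0 := by rintro rfl; simp at hdeg; exact absurd hdeg.symm (by exact_mod_cast WithBot.coe_ne_bot)
  have hnd : P.natDegree = n + 1 := natDegree_eq_of_degree_eq_some hdeg
  obtain ⟨R, hR⟩ := dvd_iff_isRoot.2 hβ
  have hR0 : R ≠ 0 := by rintro rfl; simp at hR; exact hP0 hR
  have hRd : R.natDegree = n := by
    rw [hR, natDegree_mul (X_sub_C_ne_zero β) hR0, natDegree_X_sub_C] at hnd
    omega
  set c := R.leadingCoeff with hc
  have hc0 : c ≠ 0 := leadingCoeff_ne_zero.2 hR0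
  have hRs : ∃ z : Fin n → ℂ, R = C c * ∏ j, (X - C (z j)) := by
    obtain ⟨z, hz⟩ := Monic.exists_fin_roots (p := C c⁻¹ * R) (n := n)
      (by rw [Monic, leadingCoeff_mul, leadingCoeff_C, ← hc, inv_mul_cancel₀ hc0])
      (by rw [natDegree_C_mul (inv_ne_zero hc0), hRd])
    refine ⟨z, ?_⟩
    rw [← hz, ← mul_assoc, ← C_mul, mul_inv_cancel₀ hc0, C_1, one_mul]
  obtain ⟨z, hz⟩ := hRs
  set p : ℂ[X] := (X - C β) * ∏ j, (X - C (z j)) with hp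
  have hPp : P = C c * p := by rw [hR, hz, hp]; ring
  have hpm : p.Monic := (monic_X_sub_C β).mul (monic_prod_fin z)
  have hpd : p.natDegree = n + 1 := by
    rw [hPp, natDegree_C_mul hc0] at hnd; exact hnd
  have hcoef : (derivative p).coeff n = (n : ℂ) + 1 := by
    rw [coeff_derivative, ← hpd, hpm.coeff_natDegree, one_mul]
  have hn1 : (n : ℂ) + 1 ≠ 0 := by exact_mod_cast Nat.succ_ne_zero n
  have hdle : (derivative p).natDegree ≤ n := by
    have := natDegree_derivative_le p
    rw [hpd] at this; exact this
  have hdd : (derivative p).natDegree = n :=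
    le_antisymm hdle (le_natDegree_of_ne_zero (by rw [hcoef]; exact hn1))
  obtain ⟨ζ, hζ⟩ := Monic.exists_fin_roots (p := C ((n : ℂ) + 1)⁻¹ * derivative p) (n := n)
    (by rw [Monic, leadingCoeff_mul, leadingCoeff_C, leadingCoeff, hdd, hcoef,
          inv_mul_cancel₀ hn1])
    (by rw [natDegree_C_mul (inv_ne_zero hn1), hdd])
  have hcfg : CritConfig n β z ζ := by
    rw [CritConfig, ← hζ, ← mul_assoc, ← C_mul, mul_inv_cancel₀ hn1, C_1, one_mul]
  refine ⟨z, ζ, hcfg, fun j => hroots _ ?_, ?_⟩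
  · rw [hR, hz, IsRoot, eval_mul, eval_mul, eval_prod,
      Finset.prod_eq_zero (Finset.mem_univ j) (by simp)]
    simp
  · ext x
    rw [Set.mem_ofPred_eq, hPp, derivative_C_mul, hp, hcfg, IsRoot, eval_C_mul, eval_C_mul,
      mul_eq_zero, or_iff_right hc0, mul_eq_zero, or_iff_right hn1, ← IsRoot, isRoot_prod_fin]
    simp [eq_comm]

/-- Critical points can be prescribed freely: take the antiderivative of `(n + 1) ∏ (X - ζ j)` that
vanishes at `β`. -/
theorem exists_roots_of_crit {n : ℕ} (β : ℂ) (ζ : Fin n → ℂ) :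
    ∃ z : Fin n → ℂ, CritConfig n β z ζ := by
  set Q : ℂ[X] := C ((n : ℂ) + 1) * ∏ j, (X - C (ζ j)) with hQ
  have hn1 : (n : ℂ) + 1 ≠ 0 := by exact_mod_cast Nat.succ_ne_zero n
  have hQd : Q.natDegree = n := by
    rw [hQ, natDegree_C_mul hn1, natDegree_prod_fin]
  set T : ℂ[X] := ∑ m ∈ Finset.range (n + 1), C (Q.coeff m / (m + 1)) * X ^ (m + 1) with hT
  have hTder : derivative T = Q := by
    rw [hT, derivative_sum]
    conv_rhs => rw [Q.as_sum_range' (n + 1) (by omega)]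
    refine Finset.sum_congr rfl fun m _ => ?_
    have : (m : ℂ) + 1 ≠ 0 := by exact_mod_cast Nat.succ_ne_zero m
    rw [derivative_C_mul_X_pow, ← C_mul_X_pow_eq_monomial]
    simp only [Nat.add_sub_cancel]
    push_cast
    rw [div_mul_cancel₀ _ this]
  set P : ℂ[X] := T - C (T.eval β) with hP
  have hPder : derivative P = Q := by rw [hP]; simp [hTder]
  have hroot : P.IsRoot β := by simp [hP]
  have hQn : Q.coeff n = (n : ℂ) + 1 := by
    rw [hQ, coeff_C_mul]
    have := (monic_prod_fin ζ).coeff_natDegree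
    rw [natDegree_prod_fin] at this
    rw [this, mul_one]
  have hPd : P.natDegree = n + 1 := by
    have h1 : P.natDegree ≤ n + 1 := by
      rw [hP]
      refine (natDegree_sub_C (a := T.eval β)).le.trans ?_
      refine natDegree_sum_le_of_forall_le _ _ fun m hm => ?_
      exact (natDegree_C_mul_X_pow_le _ _).trans (by have := Finset.mem_range.1 hm; omega)
    refine le_antisymm h1 (le_natDegree_of_ne_zero ?_)
    have := coeff_derivative P n
    rw [hPder, hQn] at this
    intro h
    rw [h, zero_mul] at this
    exact hn1 this
  have hPm : P.Monic := by
    rw [Monic, leadingCoeff, hPd]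
    have := coeff_derivative P n
    rw [hPder, hQn] at this
    exact mul_right_cancel₀ hn1 (by rw [one_mul, ← this])
  obtain ⟨R, hR⟩ := dvd_iff_isRoot.2 hroot
  have hRm : R.Monic := (monic_X_sub_C β).of_mul_monic_left (hR ▸ hPm)
  have hRd : R.natDegree = n := by
    rw [hR, (monic_X_sub_C β).natDegree_mul hRm, natDegree_X_sub_C] at hPd
    omega
  obtain ⟨z, hz⟩ := hRm.exists_fin_roots hRd
  exact ⟨z, by rw [CritConfig, ← hz, ← hR, hPder]⟩

theorem mem_sendovClass {n : ℕ} {β : ℂ} {z : Fin n → ℂ} (hβ : ‖β‖ ≤ 1) (hz : ∀ j, ‖z j‖ ≤ 1) :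
    (X - C β) * ∏ j, (X - C (z j)) ∈ sendovClass (n + 1) β := by
  refine ⟨?_, fun x hx => ?_, by simp⟩
  · rw [degree_mul, degree_X_sub_C, degree_eq_natDegree (monic_prod_fin z).ne_zero,
      natDegree_prod_fin, add_comm]
    rfl
  · rw [IsRoot, eval_mul, mul_eq_zero, ← IsRoot, ← IsRoot, isRoot_prod_fin, root_X_sub_C] at hx
    rcases hx with rfl | ⟨j, rfl⟩
    exacts [hβ, hz j]

namespace CritConfig

variable {n : ℕ} {β : ℂ} {z ζ : Fin n → ℂ}

theorem setOf_isRoot (h : CritConfig n β z ζ) :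
    {x | (derivative ((X - C β) * ∏ j, (X - C (z j)))).IsRoot x} = Set.range ζ := by
  have hn1 : (n : ℂ) + 1 ≠ 0 := by exact_mod_cast Nat.succ_ne_zero n
  ext x
  rw [Set.mem_ofPred_eq, h, IsRoot, eval_C_mul, mul_eq_zero, or_iff_right hn1, ← IsRoot,
    isRoot_prod_fin]
  simp [eq_comm]

theorem prod_eq (h : CritConfig n β z ζ) :
    ((n : ℂ) + 1) * ∏ j, (β - ζ j) = ∏ j, (β - z j) := by
  have := congrArg (eval β) h
  rw [derivative_mul, eval_add, eval_mul, eval_mul, eval_C_mul, eval_prod, eval_prod] at this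
  simpa using this.symm

/-- For `P = (X - β) R` one has `P'(β) = R(β)` and `P''(β) = 2 R'(β)`, so the logarithmic derivative
of `P'` at `β` is twice that of `R`. -/
theorem sum_inv (h : CritConfig n β z ζ) (hz : ∀ j, β ≠ z j) :
    ∑ j, 1 / (β - ζ j) = 2 * ∑ j, 1 / (β - z j) := by
  set R := ∏ j, (X - C (z j)) with hR
  set Q := ∏ j, (X - C (ζ j)) with hQ
  have hn1 : (n : ℂ) + 1 ≠ 0 := by exact_mod_cast Nat.succ_ne_zero n
  have hsplit : ∀ (f : Fin n → ℂ), (∀ j, β ≠ f j) →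
      (derivative (∏ j, (X - C (f j)))).eval β =
        (∏ j, (X - C (f j))).eval β * ∑ j, 1 / (β - f j) := by
    intro f hf
    rw [derivative_prod_finset, eval_finsetSum, eval_prod, Finset.mul_sum]
    refine Finset.sum_congr rfl fun j _ => ?_
    rw [eval_mul, eval_prod, ← Finset.mul_prod_erase _ _ (Finset.mem_univ j)]
    have : β - f j ≠ 0 := sub_ne_zero.2 (hf j)
    simp
    field_simp
  have hev := h.prod_eq
  have hRne : ∏ j, (β - z j) ≠ 0 := Finset.prod_ne_zero_iff.2 fun j _ => sub_ne_zero.2 (hz j)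
  have hζ : ∀ j, β ≠ ζ j := by
    intro j hj
    rw [Finset.prod_eq_zero (Finset.mem_univ j) (by rw [hj, sub_self]), mul_zero] at hev
    exact hRne hev.symm
  have h2 := congrArg (fun p => eval β (derivative p)) h
  simp only [derivative_mul, derivative_X_sub_C, one_mul, derivative_add, derivative_C,
    zero_mul, zero_add, eval_add, eval_mul, eval_sub, eval_X, eval_C, sub_self, add_zero] at h2
  rw [hsplit z hz, hsplit ζ hζ] at h2
  simp only [eval_prod, eval_sub, eval_X, eval_C] at h2
  rw [← hev] at h2 hRne
  have : (((n : ℂ) + 1) * ∏ j, (β - ζ j)) * ∑ j, 1 / (β - ζ j) =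
      (((n : ℂ) + 1) * ∏ j, (β - ζ j)) * (2 * ∑ j, 1 / (β - z j)) := by
    linear_combination -h2
  exact mul_left_cancel₀ hRne this

end CritConfig

/-! ### The polynomial expressed through the coefficients of its derivative -/

/-- Up to sign, the `k`-th elementary symmetric function of the `ζ j`. -/
noncomputable def revCoeff {n : ℕ} (ζ : Fin n → ℂ) (k : ℕ) : ℂ :=
  (∏ j, (1 - C (ζ j) * X)).coeff k

theorem reverse_prod_X_sub_C {ι : Type*} (s : Finset ι) (f : ι → ℂ) :
    (∏ j ∈ s, (X - C (f j))).reverse = ∏ j ∈ s, (1 - C (f j) * X) := by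
  classical
  induction s using Finset.induction_on with
  | empty => simpa using reverse_C (1 : ℂ)
  | insert a s ha ih =>
    rw [Finset.prod_insert ha, Finset.prod_insert ha, reverse_mul_of_domain, ih]
    congr 1
    have : X - C (f a) = C (-f a) + X := by rw [C_neg]; ring
    ext k
    rw [coeff_reverse, natDegree_X_sub_C]
    rcases k with _ | _ | k
    · simp [revAt_le]
    · simp [revAt_le, coeff_one]
    · rw [revAt_eq_self_of_lt (by omega)]
      simp [coeff_X, coeff_one]

theorem coeff_prod_X_sub_C {n : ℕ} (ζ : Fin n → ℂ) {k : ℕ} (hk : k ≤ n) :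
    (∏ j, (X - C (ζ j))).coeff (n - k) = revCoeff ζ k := by
  rw [revCoeff, ← reverse_prod_X_sub_C, coeff_reverse, natDegree_prod_fin, revAt_le hk]

/-- This is `P(x) - P(β)`, the termwise integral of `P'` from `β` to `x`. -/
theorem CritConfig.eval_eq {n : ℕ} {β : ℂ} {z ζ : Fin n → ℂ} (h : CritConfig n β z ζ) (x : ℂ) :
    (x - β) * ∏ j, (x - z j) = ∑ k ∈ Finset.range (n + 1),
      ((n : ℂ) + 1) * revCoeff ζ k / ((n : ℂ) + 1 - k) * (x ^ (n + 1 - k) - β ^ (n + 1 - k)) := by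
  set p : ℂ[X] := (X - C β) * ∏ j, (X - C (z j)) with hp
  have hpd : p.natDegree = n + 1 := by
    rw [hp, (monic_X_sub_C β).natDegree_mul (monic_prod_fin z), natDegree_X_sub_C,
      natDegree_prod_fin, add_comm]
  have e : (x - β) * ∏ j, (x - z j) = eval x p - eval β p := by
    simp [hp, eval_prod]
  rw [e, eval_eq_sum_range, eval_eq_sum_range, ← Finset.sum_sub_distrib, hpd,
    Finset.sum_range_succ', ← Finset.sum_range_reflect]
  simp only [pow_zero, sub_self, add_zero]
  refine Finset.sum_congr rfl fun k hk => ?_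
  have hk' : k ≤ n := by have := Finset.mem_range.1 hk; omega
  have e1 : n + 1 - 1 - k = n - k := by omega
  have e2 : n + 1 - k = n - k + 1 := by omega
  rw [e1, e2, ← mul_sub]
  congr 1
  have := coeff_derivative p (n - k)
  rw [hp, h, coeff_C_mul, coeff_prod_X_sub_C ζ hk', ← hp] at this
  rw [Nat.cast_sub hk'] at this
  have h0 : (n : ℂ) - k + 1 ≠ 0 := by
    rw [← Nat.cast_sub hk']; exact_mod_cast Nat.succ_ne_zero (n - k)
  have h0' : (n : ℂ) + 1 - k ≠ 0 := by rwa [add_sub_right_comm]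
  rw [eq_div_iff h0', this]
  ring

/-! ### A priori bounds on the critical points -/

/-- In `(n + 1) ∏ |β - ζ j| = ∏ |β - z j|` the left side is at least `2⁻ⁿ`, while every factor on
the right is at most `2`; hence no factor can be small. -/
theorem CritConfig.one_div_le_norm {n : ℕ} {ε : ℝ} (hε0 : 0 ≤ ε) (hε : ε ≤ 1 / 2)
    {z ζ : Fin n → ℂ} (h : CritConfig n ((1 - ε : ℝ) : ℂ) z ζ) (hz : ∀ j, ‖z j‖ ≤ 1)
    (hζ : ∀ j, 1 - ε ≤ ‖((1 - ε : ℝ) : ℂ) - ζ j‖) (j : Fin n) :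
    1 / 4 ^ n ≤ ‖((1 - ε : ℝ) : ℂ) - z j‖ := by
  set b : ℂ := ((1 - ε : ℝ) : ℂ) with hb
  have hbn : ‖b‖ ≤ 1 := by
    rw [hb, Complex.norm_real, Real.norm_eq_abs, abs_le]; constructor <;> linarith
  have h2 : ∀ j, ‖b - z j‖ ≤ 2 := fun j => (norm_sub_le _ _).trans (by linarith [hz j])
  have h1 : (1 / 2 : ℝ) ^ n ≤ ∏ j, ‖b - ζ j‖ := by
    have := Finset.prod_le_prod (s := (Finset.univ : Finset (Fin n))) (f := fun _ => (1 / 2 : ℝ))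
      (g := fun j => ‖b - ζ j‖) (fun _ _ => by norm_num) (fun j _ => by linarith [hζ j])
    simpa using this
  have h3 := congrArg norm h.prod_eq
  rw [norm_mul, norm_prod, norm_prod, ← Finset.mul_prod_erase _ (fun k => ‖b - z k‖) (Finset.mem_univ j)] at h3
  have h4 : ∏ k ∈ Finset.univ.erase j, ‖b - z k‖ ≤ 2 ^ n := by
    refine (Finset.prod_le_prod (fun _ _ => norm_nonneg _) fun k _ => h2 k).trans ?_
    rw [Finset.prod_const]
    exact pow_le_pow_right₀ (by norm_num) (by simp)
  have h5 : (1 : ℝ) ≤ ‖(n : ℂ) + 1‖ := by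
    have : ‖(n : ℂ) + 1‖ = (n : ℝ) + 1 := by
      rw [← Nat.cast_succ, Complex.norm_natCast]; push_cast; ring
    rw [this]; linarith [Nat.cast_nonneg (α := ℝ) n]
  have h6 : (1 / 2 : ℝ) ^ n ≤ ‖b - z j‖ * 2 ^ n := by
    calc (1 / 2 : ℝ) ^ n ≤ 1 * ∏ j, ‖b - ζ j‖ := by rwa [one_mul]
      _ ≤ ‖(n : ℂ) + 1‖ * ∏ j, ‖b - ζ j‖ :=
        mul_le_mul_of_nonneg_right h5 (Finset.prod_nonneg fun _ _ => norm_nonneg _)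
      _ = _ := h3
      _ ≤ _ := mul_le_mul_of_nonneg_left h4 (norm_nonneg _)
  rw [← div_le_iff₀ (by positivity)] at h6
  refine le_trans (le_of_eq ?_) h6
  rw [div_pow, one_pow, div_div, ← mul_pow]
  norm_num

/-- The map `z ↦ 1/(1 - z)` sends the unit disk into `Re ≥ 1/2`. Moving the pole from `1` to `1 - ε`
costs `O(ε)` as long as `z` stays at distance `d` from it. -/
theorem re_one_div_ge {b d ε : ℝ} (hε : ε ≤ 1 / 2) (hb : b = 1 - ε) (hε0 : 0 ≤ ε)
    (hd : 0 < d) {z : ℂ} (hz : ‖z‖ ≤ 1) (hw : d ≤ ‖(b : ℂ) - z‖) :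
    1 / 2 - 2 * ε / d ^ 2 ≤ (1 / ((b : ℂ) - z)).re := by
  set w := (b : ℂ) - z with hwdef
  have hw0 : 0 < ‖w‖ := hd.trans_le hw
  have hsq : 0 < ‖w‖ ^ 2 := by positivity
  have hre : (1 / w).re = w.re / ‖w‖ ^ 2 := by
    rw [one_div, Complex.inv_re, Complex.normSq_eq_norm_sq]
  have hz2 : (b - w.re) ^ 2 + w.im ^ 2 ≤ 1 := by
    have h1 : ‖z‖ ^ 2 ≤ 1 := by nlinarith [norm_nonneg z]
    rw [← Complex.normSq_eq_norm_sq, Complex.normSq_apply] at h1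
    have e : z = b - w := by rw [hwdef]; ring
    rw [e] at h1
    simp at h1
    nlinarith
  have hn : ‖w‖ ^ 2 = w.re ^ 2 + w.im ^ 2 := by
    rw [← Complex.normSq_eq_norm_sq, Complex.normSq_apply]; ring
  have key : ‖w‖ ^ 2 / 2 - 2 * ε ≤ w.re := by
    rw [hb] at hz2
    rcases le_total 0 w.re with h | h
    · nlinarith [mul_nonneg h hε0]
    · nlinarith [mul_nonneg (neg_nonneg.2 h) (by linarith : 0 ≤ 1 / 2 - ε),
        sq_nonneg w.re, sq_nonneg w.im]
  rw [hre, le_div_iff₀ hsq]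
  have h3 : 2 * ε ≤ 2 * ε / d ^ 2 * ‖w‖ ^ 2 := by
    rw [div_mul_eq_mul_div, le_div_iff₀ (by positivity)]
    have : d ^ 2 ≤ ‖w‖ ^ 2 := by gcongr
    nlinarith
  linarith

/-- The condition `Re (1/w) ≥ 1 - t` is a disk through `0` of diameter `1/(1 - t)`. Outside the
circle of radius `1 - ε` only a thin lens near `1` remains, whose width is of first order and whose
height is of order one half. -/
theorem crit_bound_of_re_inv {ε t u v : ℝ} (hε0 : 0 ≤ ε) (ht0 : 0 ≤ t) (ht : t ≤ 1 / 8)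
    (hε : ε ≤ 1 / 8) (h1 : (1 - ε) ^ 2 ≤ u ^ 2 + v ^ 2) (h2 : (1 - t) * (u ^ 2 + v ^ 2) ≤ u) :
    1 - t - 2 * ε ≤ u ∧ u ≤ 1 + 2 * t ∧ v ^ 2 ≤ 2 * (3 * t + 2 * ε) := by
  have hu : 1 - t - 2 * ε ≤ u := by
    have := mul_le_mul_of_nonneg_left h1 (by linarith : 0 ≤ 1 - t)
    nlinarith [mul_nonneg ht0 hε0, mul_nonneg hε0 hε0]
  have hu0 : 0 < u := by linarith
  have h3 : u ^ 2 + v ^ 2 ≤ u * (1 + 2 * t) := by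
    have : (1 - t) * (u ^ 2 + v ^ 2) ≤ (1 - t) * (u * (1 + 2 * t)) := by
      nlinarith [mul_nonneg hu0.le (mul_nonneg ht0 (by linarith : 0 ≤ 1 - 2 * t))]
    exact le_of_mul_le_mul_left this (by linarith)
  have hu2 : u ≤ 1 + 2 * t := by
    by_contra hcon
    push Not at hcon
    nlinarith [sq_nonneg v]
  refine ⟨hu, hu2, ?_⟩
  nlinarith

/-- Each `Re 1/(β - ζ j)` is at most `1 + 2ε`, but by `sum_inv` and `re_one_div_ge` they sum to at
least `n - O(ε)`. So each is at least `1 - O(ε)`, and the lens estimate applies. -/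
theorem CritConfig.crit_bound (n : ℕ) : ∃ D : ℝ, 0 < D ∧ ∀ (ε : ℝ) (z ζ : Fin n → ℂ),
    0 ≤ ε → D * ε ≤ 1 → CritConfig n ((1 - ε : ℝ) : ℂ) z ζ → (∀ j, ‖z j‖ ≤ 1) →
    (∀ j, 1 - ε ≤ ‖((1 - ε : ℝ) : ℂ) - ζ j‖) →
    ∀ j, |(ζ j).re| ≤ D * ε ∧ (ζ j).im ^ 2 ≤ D * ε := by
  set d : ℝ := 1 / 4 ^ n with hd
  have hd0 : 0 < d := by positivity
  -- The first term is the total loss in the bound for the roots, the second the excess `2ε` of the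
  -- remaining critical points.
  set E : ℝ := 4 * n / d ^ 2 + 2 * n with hE
  have hE0 : 0 ≤ E := by positivity
  refine ⟨8 * E + 8, by linarith, fun ε z ζ hε0 hε h hz hζ j => ?_⟩
  have hε8 : ε ≤ 1 / 8 := by nlinarith [mul_nonneg hE0 hε0]
  have hb : ∀ j, ((1 - ε : ℝ) : ℂ) ≠ z j := by
    intro j hj
    have := h.one_div_le_norm hε0 (by linarith) hz hζ j
    rw [hj, sub_self, norm_zero] at this
    exact absurd this (not_le.2 hd0)
  have hsum := congrArg Complex.re (h.sum_inv hb)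
  have hlow : n * (1 - 4 * ε / d ^ 2) ≤ (2 * ∑ j, 1 / (((1 - ε : ℝ) : ℂ) - z j)).re := by
    have : ∑ _j : Fin n, (1 / 2 - 2 * ε / d ^ 2) ≤ ∑ j, (1 / (((1 - ε : ℝ) : ℂ) - z j)).re :=
      Finset.sum_le_sum fun j _ => re_one_div_ge (by linarith) rfl hε0 hd0 (hz j)
        (h.one_div_le_norm hε0 (by linarith) hz hζ j)
    have e : (2 * ∑ j, 1 / (((1 - ε : ℝ) : ℂ) - z j)).re
        = 2 * ∑ j, (1 / (((1 - ε : ℝ) : ℂ) - z j)).re := by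
      rw [← Complex.re_sum]; simp
    rw [e]
    simp only [Finset.sum_const, Finset.card_univ, Fintype.card_fin, nsmul_eq_mul] at this
    have e2 : (n : ℝ) * (1 - 4 * ε / d ^ 2) = 2 * (n * (1 / 2 - 2 * ε / d ^ 2)) := by ring
    rw [e2]; linarith
  rw [← hsum, Complex.re_sum, ← Finset.add_sum_erase _ _ (Finset.mem_univ j)] at hlow
  have hup : ∀ j, (1 / (((1 - ε : ℝ) : ℂ) - ζ j)).re ≤ 1 + 2 * ε := by
    intro j
    refine (Complex.re_le_norm _).trans ?_
    rw [norm_div, norm_one]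
    have h1 : 0 < 1 - ε := by linarith
    refine (one_div_le_one_div_of_le h1 (hζ j)).trans ?_
    rw [div_le_iff₀ h1]
    nlinarith
  have hup' : ∑ k ∈ Finset.univ.erase j, (1 / (((1 - ε : ℝ) : ℂ) - ζ k)).re
      ≤ ((n : ℝ) - 1) * (1 + 2 * ε) := by
    refine (Finset.sum_le_sum fun k _ => hup k).trans (le_of_eq ?_)
    have hn : 1 ≤ n := by have := j.2; omega
    rw [Finset.sum_const, Finset.card_erase_of_mem (Finset.mem_univ j), Finset.card_univ,
      Fintype.card_fin, nsmul_eq_mul, Nat.cast_sub hn, Nat.cast_one]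
  set w : ℂ := ((1 - ε : ℝ) : ℂ) - ζ j with hw
  have hre : 1 - E * ε ≤ (1 / w).re := by
    have e : E * ε = n * (4 * ε / d ^ 2) + 2 * n * ε := by rw [hE]; ring
    rw [e]; nlinarith
  have hw0 : 0 < ‖w‖ := lt_of_lt_of_le (by linarith) (hζ j)
  have hn2 : ‖w‖ ^ 2 = w.re ^ 2 + w.im ^ 2 := by
    rw [← Complex.normSq_eq_norm_sq, Complex.normSq_apply]; ring
  rw [one_div, Complex.inv_re, Complex.normSq_eq_norm_sq, le_div_iff₀ (by positivity), hn2] at hre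
  have hζ2 : (1 - ε) ^ 2 ≤ w.re ^ 2 + w.im ^ 2 := by
    rw [← hn2]
    exact pow_le_pow_left₀ (by linarith) (hζ j) 2
  obtain ⟨h1, h2, h3⟩ := crit_bound_of_re_inv hε0 (mul_nonneg hE0 hε0) (by linarith) hε8 hζ2 hre
  have e1 : w.re = 1 - ε - (ζ j).re := by simp [hw]
  have e2 : w.im = - (ζ j).im := by simp [hw]
  have := mul_nonneg hE0 hε0
  rw [e1] at h1 h2
  rw [e2, neg_sq] at h3
  refine ⟨abs_le.2 ⟨?_, ?_⟩, ?_⟩ <;> linarith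

/-! ### The first coefficients and their orders of magnitude -/

section RevCoeff

variable {κ : Type*} (s : Finset κ) (f : κ → ℂ)

theorem coeff_zero_prod_one_sub : (∏ j ∈ s, (1 - C (f j) * X)).coeff 0 = 1 := by
  simp [coeff_zero_eq_eval_zero, eval_prod]

theorem coeff_one_sub_C_mul_X_mul_succ (a : ℂ) (p : ℂ[X]) (k : ℕ) :
    ((1 - C a * X) * p).coeff (k + 1) = p.coeff (k + 1) - a * p.coeff k := by
  rw [sub_mul, one_mul, coeff_sub, mul_assoc, coeff_C_mul, coeff_X_mul]

theorem coeff_one_prod_one_sub : (∏ j ∈ s, (1 - C (f j) * X)).coeff 1 = -∑ j ∈ s, f j := by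
  classical
  induction s using Finset.induction_on with
  | empty => simp [coeff_one]
  | insert a s ha ih =>
    rw [Finset.prod_insert ha, Finset.sum_insert ha, coeff_one_sub_C_mul_X_mul_succ, ih,
      coeff_zero_prod_one_sub]
    ring

theorem coeff_two_prod_one_sub : (∏ j ∈ s, (1 - C (f j) * X)).coeff 2 =
    ((∑ j ∈ s, f j) ^ 2 - ∑ j ∈ s, f j ^ 2) / 2 := by
  classical
  induction s using Finset.induction_on with
  | empty => simp [coeff_one]
  | insert a s ha ih =>
    rw [Finset.prod_insert ha, Finset.sum_insert ha, Finset.sum_insert ha,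
      coeff_one_sub_C_mul_X_mul_succ, ih, coeff_one_prod_one_sub]
    ring

end RevCoeff

section Asymptotics

variable {ι : Type*} {l : Filter ι} {r : ι → ℝ}

theorem isBigO_re {f : ι → ℂ} {g : ι → ℝ} (h : f =O[l] g) : (fun i => (f i).re) =O[l] g :=
  (isBigO_of_le l fun i => by simpa using Complex.abs_re_le_norm (f i)).trans h

theorem isBigO_im {f : ι → ℂ} {g : ι → ℝ} (h : f =O[l] g) : (fun i => (f i).im) =O[l] g :=
  (isBigO_of_le l fun i => by simpa using Complex.abs_im_le_norm (f i)).trans h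

theorem isBigO_of_re_im {f : ι → ℂ} {g : ι → ℝ} (h₁ : (fun i => (f i).re) =O[l] g)
    (h₂ : (fun i => (f i).im) =O[l] g) : f =O[l] g :=
  (isBigO_of_le l fun i => by
    rw [Real.norm_of_nonneg (add_nonneg (norm_nonneg _) (norm_nonneg _))]
    exact Complex.norm_le_abs_re_add_abs_im (f i)).trans (h₁.norm_left.add h₂.norm_left)

theorem isBigO_pow_of_le {g : ι → ℝ} (hg : Tendsto g l (𝓝 0)) {a b : ℕ} (h : a ≤ b) :
    (fun i => g i ^ b) =O[l] (fun i => g i ^ a) := by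
  obtain ⟨c, rfl⟩ := Nat.exists_eq_add_of_le h
  have : (fun i => g i ^ c) =O[l] (fun _ => (1 : ℝ)) := (hg.pow c).isBigO_one ℝ
  simpa [pow_add] using (isBigO_refl (fun i => g i ^ a) l).mul this

variable {n : ℕ} {ζ : ι → Fin n → ℂ}

theorem revCoeff_isBigO (h : ∀ j, (fun i => ζ i j) =O[l] r) (k : ℕ) :
    (fun i => revCoeff (ζ i) k) =O[l] (fun i => r i ^ k) := by
  classical
  have : ∀ (s : Finset (Fin n)) k,
      (fun i => (∏ j ∈ s, (1 - C (ζ i j) * X)).coeff k) =O[l] (fun i => r i ^ k) := by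
    intro s
    induction s using Finset.induction_on with
    | empty =>
      intro k
      rcases k with _ | k
      · simpa using isBigO_refl (fun _ => (1 : ℂ)) l |>.trans
          (isBigO_of_le l (g := fun _ => (1 : ℝ)) (by simp))
      · simpa [coeff_one] using isBigO_zero _ l
    | insert a s ha ih =>
      intro k
      simp only [Finset.prod_insert ha]
      rcases k with _ | k
      · have := ih 0
        simpa [mul_coeff_zero] using this
      · simp only [coeff_one_sub_C_mul_X_mul_succ]
        refine (ih (k + 1)).sub ?_
        simpa [pow_succ'] using (h a).mul (ih k)
  exact this Finset.univ k

/-- Only `k = 3` needs care, as the crude order is `r ^ k`. The critical points are imaginary up to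
`O(r²)`, so a product of three is imaginary up to `O(r⁴)`; the induction carries the parity through
the lower coefficients. -/
theorem re_revCoeff_isBigO (hr : Tendsto r l (𝓝 0)) (h : ∀ j, (fun i => ζ i j) =O[l] r)
    (hre : ∀ j, (fun i => (ζ i j).re) =O[l] (fun i => r i ^ 2)) {k : ℕ} (hk : 3 ≤ k) :
    (fun i => (revCoeff (ζ i) k).re) =O[l] (fun i => r i ^ 4) := by
  classical
  rcases hk.eq_or_lt with rfl | hk
  swap
  · exact isBigO_re ((revCoeff_isBigO h k).trans (isBigO_pow_of_le hr hk))
  have him : ∀ j, (fun i => (ζ i j).im) =O[l] r := fun j => isBigO_im (h j)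
  have : ∀ s : Finset (Fin n),
      ((fun i => ((∏ j ∈ s, (1 - C (ζ i j) * X)).coeff 1).re) =O[l] (fun i => r i ^ 2)) ∧
      ((fun i => ((∏ j ∈ s, (1 - C (ζ i j) * X)).coeff 1).im) =O[l] r) ∧
      ((fun i => ((∏ j ∈ s, (1 - C (ζ i j) * X)).coeff 2).re) =O[l] (fun i => r i ^ 2)) ∧
      ((fun i => ((∏ j ∈ s, (1 - C (ζ i j) * X)).coeff 2).im) =O[l] (fun i => r i ^ 3)) ∧
      ((fun i => ((∏ j ∈ s, (1 - C (ζ i j) * X)).coeff 3).re) =O[l] (fun i => r i ^ 4)) := by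
    intro s
    induction s using Finset.induction_on with
    | empty => simp [coeff_one, isBigO_zero]
    | insert a s ha ih =>
      obtain ⟨h1r, h1i, h2r, h2i, h3r⟩ := ih
      have e1 : (fun i => r i ^ 2 * r i) = fun i => r i ^ 3 := by ext; ring
      have e2 : (fun i => r i * r i) = fun i => r i ^ 2 := by ext; ring
      have e3 : (fun i => r i * r i ^ 2) = fun i => r i ^ 3 := by ext; ring
      have e4 : (fun i => r i ^ 2 * r i ^ 2) = fun i => r i ^ 4 := by ext; ring
      have e5 : (fun i => r i * r i ^ 3) = fun i => r i ^ 4 := by ext; ring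
      have le42 := isBigO_pow_of_le hr (show 2 ≤ 4 by norm_num)
      simp only [Finset.prod_insert ha, coeff_one_sub_C_mul_X_mul_succ,
        coeff_zero_prod_one_sub, Complex.sub_re, Complex.sub_im, Complex.mul_re,
        Complex.mul_im, mul_one]
      refine ⟨h1r.sub (hre a), h1i.sub (him a),
        h2r.sub (((e4 ▸ (hre a).mul h1r).trans le42).sub (e2 ▸ (him a).mul h1i)),
        h2i.sub ((e1 ▸ (hre a).mul h1i).add (e3 ▸ (him a).mul h1r)),
        h3r.sub ((e4 ▸ (hre a).mul h2r).sub (e5 ▸ (him a).mul h2i))⟩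
  exact (this Finset.univ).2.2.2.2

theorem pow_sub_pow_isBigO {x y : ι → ℂ} {g : ι → ℝ} (hx : x =O[l] (fun _ => (1 : ℝ)))
    (hy : y =O[l] (fun _ => (1 : ℝ))) (h : (fun i => x i - y i) =O[l] g) (m : ℕ) :
    (fun i => x i ^ m - y i ^ m) =O[l] g := by
  have e : (fun i => x i ^ m - y i ^ m) =
      fun i => (x i - y i) * ∑ k ∈ Finset.range m, x i ^ k * y i ^ (m - 1 - k) := by
    ext i
    rw [mul_comm, ← geom_sum₂_mul]
  rw [e]
  have : (fun i => ∑ k ∈ Finset.range m, x i ^ k * y i ^ (m - 1 - k)) =O[l]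
      (fun _ => (1 : ℝ)) := by
    refine IsBigO.fun_sum fun k _ => ?_
    simpa using (hx.pow k).mul (hy.pow (m - 1 - k))
  simpa using h.mul this

/-! ### Roots near the roots of unity -/

/-- The part of the expansion of the `(n+1)`-st power of a root near `ω` which is linear in the
coefficients. -/
noncomputable def linPart (n : ℕ) (q : ℕ → ℂ) (x y : ℂ) : ℂ :=
  ∑ k ∈ Finset.range n, ((n : ℂ) + 1) * q (k + 1) / ((n : ℂ) - k) * (x ^ (n - k) - y ^ (n - k))

theorem CritConfig.eval_eq_linPart {n : ℕ} {β : ℂ} {z ζ : Fin n → ℂ} (h : CritConfig n β z ζ)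
    (x : ℂ) : (x - β) * ∏ j, (x - z j) =
      x ^ (n + 1) - β ^ (n + 1) + linPart n (revCoeff ζ) x β := by
  have hn1 : (n : ℂ) + 1 ≠ 0 := by exact_mod_cast Nat.succ_ne_zero n
  rw [h.eval_eq, Finset.sum_range_succ', linPart, add_comm]
  congr 1
  · rw [revCoeff, coeff_zero_prod_one_sub]
    simp [div_self hn1]
  · refine Finset.sum_congr rfl fun k _ => ?_
    have e1 : n + 1 - (k + 1) = n - k := by omega
    have e2 : (n : ℂ) + 1 - ((k + 1 : ℕ) : ℂ) = n - k := by push_cast; ring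
    rw [e1, e2]

theorem CritConfig.pow_eq {n : ℕ} {β : ℂ} {z ζ : Fin n → ℂ} (h : CritConfig n β z ζ)
    (j : Fin n) : z j ^ (n + 1) = β ^ (n + 1) - linPart n (revCoeff ζ) (z j) β := by
  have := h.eval_eq_linPart (z j)
  rw [Finset.prod_eq_zero (Finset.mem_univ j) (sub_self _), mul_zero] at this
  linear_combination -this

variable {β x : ι → ℂ} {ω : ℂ} {q : ι → ℕ → ℂ} {g : ι → ℝ}

theorem linPart_isBigO (hq : ∀ k, (fun i => q i (k + 1)) =O[l] g)
    (hx : x =O[l] (fun _ => (1 : ℝ))) (hβ : β =O[l] (fun _ => (1 : ℝ))) :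
    (fun i => linPart n (q i) (x i) (β i)) =O[l] g := by
  refine IsBigO.fun_sum fun k _ => ?_
  have h1 : (fun i => ((n : ℂ) + 1) * q i (k + 1) / ((n : ℂ) - k)) =O[l] g := by
    have := (hq k).const_mul_left (((n : ℂ) + 1) / ((n : ℂ) - k))
    refine this.congr_left fun i => ?_
    ring
  have h2 : (fun i => x i ^ (n - k) - β i ^ (n - k)) =O[l] (fun _ => (1 : ℝ)) := by
    simpa using (hx.pow (n - k)).sub (by simpa using hβ.pow (n - k))
  simpa using h1.mul h2

theorem linPart_sub_isBigO (hq : ∀ k, (fun i => q i (k + 1)) =O[l] g)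
    (hx : x =O[l] (fun _ => (1 : ℝ))) (hβ : β =O[l] (fun _ => (1 : ℝ)))
    (hxω : (fun i => x i - ω) =O[l] g) (hβ1 : (fun i => β i - 1) =O[l] g) :
    (fun i => linPart n (q i) (x i) (β i) - linPart n (q i) ω 1) =O[l] (fun i => g i ^ 2) := by
  simp only [linPart, ← Finset.sum_sub_distrib, ← mul_sub]
  refine IsBigO.fun_sum fun k _ => ?_
  have h1 : (fun i => ((n : ℂ) + 1) * q i (k + 1) / ((n : ℂ) - k)) =O[l] g := by
    have := (hq k).const_mul_left (((n : ℂ) + 1) / ((n : ℂ) - k))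
    refine this.congr_left fun i => ?_
    ring
  have h2 : (fun i => x i ^ (n - k) - β i ^ (n - k) - (ω ^ (n - k) - 1 ^ (n - k))) =O[l] g := by
    have hω : (fun _ : ι => ω) =O[l] (fun _ => (1 : ℝ)) := isBigO_const_const _ one_ne_zero _
    have h1' : (fun _ : ι => (1 : ℂ)) =O[l] (fun _ => (1 : ℝ)) :=
      isBigO_const_const _ one_ne_zero _
    refine ((pow_sub_pow_isBigO hx hω hxω (n - k)).sub
      (pow_sub_pow_isBigO hβ h1' hβ1 (n - k))).congr_left fun i => ?_
    ring
  simpa [pow_two] using h1.mul h2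

theorem root_sub_isBigO (hω : ω ^ (n + 1) = 1) (hq : ∀ k, (fun i => q i (k + 1)) =O[l] g)
    (hβ : Tendsto β l (𝓝 1)) (hβ1 : (fun i => β i - 1) =O[l] g) (hx : Tendsto x l (𝓝 ω))
    (heq : ∀ i, x i ^ (n + 1) = β i ^ (n + 1) - linPart n (q i) (x i) (β i)) :
    (fun i => x i ^ (n + 1) - 1) =O[l] g ∧ (fun i => x i - ω) =O[l] g := by
  have hβO : β =O[l] (fun _ => (1 : ℝ)) := hβ.isBigO_one ℝ
  have hxO : x =O[l] (fun _ => (1 : ℝ)) := hx.isBigO_one ℝ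
  have h1' : (fun _ : ι => (1 : ℂ)) =O[l] (fun _ => (1 : ℝ)) :=
    isBigO_const_const _ one_ne_zero _
  have hN : (fun i => x i ^ (n + 1) - 1) =O[l] g := by
    refine ((pow_sub_pow_isBigO hβO h1' hβ1 (n + 1)).sub
      (linPart_isBigO (n := n) hq hxO hβO)).congr_left fun i => ?_
    rw [heq i]; ring
  refine ⟨hN, ?_⟩
  -- The cofactor of `x - ω` in `x ^ (n+1) - ω ^ (n+1)`; its limit `(n + 1) ω ^ n` is nonzero, so
  -- dividing by it loses nothing.
  set G : ι → ℂ := fun i => ∑ k ∈ Finset.range (n + 1), x i ^ k * ω ^ (n + 1 - 1 - k) with hG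
  have hGlim : Tendsto G l (𝓝 (∑ k ∈ Finset.range (n + 1), ω ^ k * ω ^ (n + 1 - 1 - k))) :=
    tendsto_finsetSum _ fun k _ => (hx.pow k).mul_const _
  have hω0 : ω ≠ 0 := by rintro rfl; simp at hω
  have hlim : ∑ k ∈ Finset.range (n + 1), ω ^ k * ω ^ (n + 1 - 1 - k) ≠ 0 := by
    have : ∀ k ∈ Finset.range (n + 1), ω ^ k * ω ^ (n + 1 - 1 - k) = ω ^ n := by
      intro k hk
      rw [← pow_add]
      congr 1
      have := Finset.mem_range.1 hk
      omega
    rw [Finset.sum_congr rfl this]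
    simp only [Finset.sum_const, Finset.card_range, nsmul_eq_mul]
    exact mul_ne_zero (by exact_mod_cast Nat.succ_ne_zero n) (pow_ne_zero _ hω0)
  have hinv : (fun i => (G i)⁻¹) =O[l] (fun _ => (1 : ℝ)) := (hGlim.inv₀ hlim).isBigO_one ℝ
  have : (fun i => (x i ^ (n + 1) - 1) * (G i)⁻¹) =O[l] g := by simpa using hN.mul hinv
  refine this.congr' ?_ EventuallyEq.rfl
  filter_upwards [hGlim.eventually_ne hlim] with i hi
  rw [← hω, ← geom_sum₂_mul, mul_comm, ← mul_assoc, inv_mul_cancel₀ hi, one_mul]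

theorem root_expansion (hω : ω ^ (n + 1) = 1) (hq : ∀ k, (fun i => q i (k + 1)) =O[l] g)
    (hβ : Tendsto β l (𝓝 1)) (hβ1 : (fun i => β i - 1) =O[l] g) (hx : Tendsto x l (𝓝 ω))
    (heq : ∀ i, x i ^ (n + 1) = β i ^ (n + 1) - linPart n (q i) (x i) (β i)) :
    (fun i => x i ^ (n + 1) - (β i ^ (n + 1) - linPart n (q i) ω 1)) =O[l]
      (fun i => g i ^ 2) := by
  have h := (root_sub_isBigO hω hq hβ hβ1 hx heq).2
  refine (linPart_sub_isBigO (n := n) hq (hx.isBigO_one ℝ) (hβ.isBigO_one ℝ) h hβ1).neg_left.congr_left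
    fun i => ?_
  rw [heq i]; ring

/-- The polynomial at `ω` tends to `ω ^ (n+1) - 1 = 0`. As `ω` stays away from `β`, the product of
its distances to the other roots tends to `0`, and the `n`-th power of the least distance is below
that product. -/
theorem exists_root_tendsto {z : ι → Fin n → ℂ} (hn : n ≠ 0)
    (hω : ω ^ (n + 1) = 1) (hω1 : ω ≠ 1)
    (h : ∀ i, CritConfig n (β i) (z i) (ζ i))
    (hq : ∀ k, Tendsto (fun i => revCoeff (ζ i) (k + 1)) l (𝓝 0)) (hβ : Tendsto β l (𝓝 1)) :
    ∃ j : ι → Fin n, Tendsto (fun i => z i (j i)) l (𝓝 ω) := by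
  have hlin : Tendsto (fun i => linPart n (revCoeff (ζ i)) ω (β i)) l (𝓝 0) := by
    have : Tendsto (fun i => linPart n (revCoeff (ζ i)) ω (β i)) l
        (𝓝 (∑ k ∈ Finset.range n, ((n : ℂ) + 1) * 0 / ((n : ℂ) - k) *
          (ω ^ (n - k) - 1 ^ (n - k)))) :=
      tendsto_finsetSum _ fun k _ => (((hq k).const_mul _).div_const _).mul
        ((hβ.pow _).const_sub _)
    simpa using this
  have hP : Tendsto (fun i => (ω - β i) * ∏ j, (ω - z i j)) l (𝓝 0) := by
    have := ((hβ.pow (n + 1)).const_sub (ω ^ (n + 1))).add hlin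
    simp only [hω, one_pow, sub_self, add_zero] at this
    refine this.congr fun i => ?_
    rw [(h i).eval_eq_linPart, hω]
  have hne : ω - 1 ≠ 0 := sub_ne_zero.2 hω1
  have hprod : Tendsto (fun i => ∏ j, (ω - z i j)) l (𝓝 0) := by
    have h1 := ((hβ.const_sub ω).inv₀ hne).mul hP
    rw [mul_zero] at h1
    refine h1.congr' ?_
    filter_upwards [(hβ.const_sub ω).eventually_ne hne] with i hi
    rw [← mul_assoc, inv_mul_cancel₀ hi, one_mul]
  have hne' : (Finset.univ : Finset (Fin n)).Nonempty := ⟨⟨0, Nat.pos_of_ne_zero hn⟩, by simp⟩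
  choose j _ hj using fun i => Finset.exists_min_image Finset.univ (fun j => ‖ω - z i j‖) hne'
  refine ⟨j, ?_⟩
  have hle : ∀ i, ‖ω - z i (j i)‖ ^ n ≤ ‖∏ j, (ω - z i j)‖ := by
    intro i
    rw [norm_prod]
    have := Finset.prod_le_prod (s := (Finset.univ : Finset (Fin n)))
      (f := fun _ => ‖ω - z i (j i)‖) (g := fun k => ‖ω - z i k‖)
      (fun _ _ => norm_nonneg _) (fun k hk => hj i k hk)
    simpa using this
  have hpow : Tendsto (fun i => ‖ω - z i (j i)‖ ^ n) l (𝓝 0) :=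
    squeeze_zero (fun i => by positivity) hle (by simpa using hprod.norm)
  have : Tendsto (fun i => ‖ω - z i (j i)‖) l (𝓝 0) := by
    have h2 := hpow.rpow_const (p := (1 / n : ℝ)) (Or.inr (by positivity))
    rw [Real.zero_rpow (by positivity)] at h2
    refine h2.congr fun i => ?_
    rw [one_div, Real.pow_rpow_inv_natCast (norm_nonneg _) hn]
  rw [tendsto_iff_norm_sub_tendsto_zero]
  refine this.congr fun i => norm_sub_rev _ _

end Asymptotics

/-! ### The linear part at a root of unity -/

theorem inv_eq_conj_of_pow_eq_one {n : ℕ} {ω : ℂ} (h : ω ^ (n + 1) = 1) :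
    ω⁻¹ = (starRingEnd ℂ) ω := by
  rw [Complex.inv_def, Complex.normSq_eq_norm_sq,
    Complex.norm_eq_one_of_pow_eq_one h (Nat.succ_ne_zero n)]
  simp

theorem pow_sub_eq_conj {n k : ℕ} {ω : ℂ} (h : ω ^ (n + 1) = 1) (hk : k ≤ n) :
    ω ^ (n - k) = (starRingEnd ℂ) (ω ^ (k + 1)) := by
  rw [map_pow, ← inv_eq_conj_of_pow_eq_one h, inv_pow]
  apply eq_inv_of_mul_eq_one_left
  rw [← pow_add, show n - k + (k + 1) = n + 1 by omega, h]

theorem re_pow_sub {n k : ℕ} {ω : ℂ} (h : ω ^ (n + 1) = 1) (hk : k ≤ n) :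
    (ω ^ (n - k)).re = (ω ^ (k + 1)).re := by
  rw [pow_sub_eq_conj h hk, Complex.conj_re]

theorem conj_pow_eq_one {n : ℕ} {ω : ℂ} (h : ω ^ (n + 1) = 1) :
    ((starRingEnd ℂ) ω) ^ (n + 1) = 1 := by rw [← map_pow, h, map_one]

/-- The real part of `linPart n q ω 1` when all the `q k` are replaced by their real parts. -/
noncomputable def reLin (n : ℕ) (q : ℕ → ℂ) (ω : ℂ) : ℝ :=
  ∑ k ∈ Finset.range n, ((n : ℝ) + 1) * (q (k + 1)).re / ((n : ℝ) - k) * ((ω ^ (n - k)).re - 1)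

theorem re_linPart (n : ℕ) (q : ℕ → ℂ) (ω : ℂ) : (linPart n q ω 1).re =
    reLin n q ω - ∑ k ∈ Finset.range n,
      ((n : ℝ) + 1) * (q (k + 1)).im / ((n : ℝ) - k) * (ω ^ (n - k)).im := by
  rw [linPart, reLin, Complex.re_sum, ← Finset.sum_sub_distrib]
  refine Finset.sum_congr rfl fun k _ => ?_
  have e : ((n : ℂ) + 1) * q (k + 1) / ((n : ℂ) - k) =
      ((((n : ℝ) + 1) / ((n : ℝ) - k) : ℝ) : ℂ) * q (k + 1) := by push_cast; ring
  rw [e, one_pow, Complex.mul_re, Complex.re_ofReal_mul, Complex.im_ofReal_mul]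
  simp only [Complex.sub_re, Complex.one_re, Complex.sub_im, Complex.one_im]
  ring

/-- Averaging over a conjugate pair cancels the imaginary parts of the coefficients, over which
there is no control at the needed order. -/
theorem re_linPart_add_conj (n : ℕ) (q : ℕ → ℂ) (ω : ℂ) :
    (linPart n q ω 1).re + (linPart n q ((starRingEnd ℂ) ω) 1).re = 2 * reLin n q ω := by
  have : reLin n q ((starRingEnd ℂ) ω) = reLin n q ω := by
    simp only [reLin, ← map_pow, Complex.conj_re]
  rw [re_linPart, re_linPart, this]
  simp only [← map_pow, Complex.conj_im, mul_neg, Finset.sum_neg_distrib]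
  ring

theorem re_linPart_of_real (n : ℕ) (q : ℕ → ℂ) (ω : ℂ) (hq : ∀ k, (q k).im = 0) :
    (linPart n q ω 1).re = reLin n q ω := by
  simp [re_linPart, hq]

/-- A constant depending monotonically on finitely many cases can be chosen uniformly. -/
theorem exists_uniform_const {α ι : Type*} {l : Filter ι} (s : Finset α)
    (p : α → ℝ → ι → Prop) (hp : ∀ a C C' i, C ≤ C' → p a C i → p a C' i)
    (h : ∀ a ∈ s, ∃ C, ∀ᶠ i in l, p a C i) :
    ∃ C, 0 ≤ C ∧ ∀ᶠ i in l, ∀ a ∈ s, p a C i := by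
  classical
  induction s using Finset.induction_on with
  | empty => exact ⟨0, le_rfl, by simp⟩
  | insert a s ha ih =>
    obtain ⟨C, hC0, hC⟩ := ih fun b hb => h b (Finset.mem_insert_of_mem hb)
    obtain ⟨C', hC'⟩ := h a (Finset.mem_insert_self _ _)
    refine ⟨max C C', le_max_of_le_left hC0, ?_⟩
    filter_upwards [hC, hC'] with i h1 h2 b hb
    rcases Finset.mem_insert.1 hb with rfl | hb
    · exact hp _ _ _ _ (le_max_right _ _) h2
    · exact hp _ _ _ _ (le_max_left _ _) (h1 b hb)

section

variable {ι : Type*} {l : Filter ι} {r : ι → ℝ} {n : ℕ}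

/-- Since `ω ^ (n-k)` is conjugate to `ω ^ (k+1)`, the first two summands are exactly the two terms
of the linear program; the rest is error. -/
theorem reLin_sub_isBigO {q : ι → ℕ → ℂ} {g : ι → ℝ} {ω : ℂ} (hn : 2 ≤ n)
    (hω : ω ^ (n + 1) = 1) (hq : ∀ k, 3 ≤ k → (fun i => (q i k).re) =O[l] g) :
    (fun i => reLin n (q i) ω + ((n : ℝ) + 1) * ((q i 1).re * (1 - ω.re) / n +
      (q i 2).re * (1 - (ω ^ 2).re) / ((n : ℝ) - 1))) =O[l] g := by
  obtain ⟨m, rfl⟩ := Nat.exists_eq_add_of_le' hn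
  have : (fun i => ∑ k ∈ Finset.range m, (((m + 2 : ℕ) : ℝ) + 1) * (q i (k + 1 + 1 + 1)).re /
      (((m + 2 : ℕ) : ℝ) - ((k + 1 + 1 : ℕ) : ℝ)) * ((ω ^ (m + 2 - (k + 1 + 1))).re - 1)) =O[l] g := by
    refine IsBigO.fun_sum fun k _ => ?_
    refine ((hq (k + 1 + 1 + 1) (by omega)).const_mul_left ((((m + 2 : ℕ) : ℝ) + 1) /
      (((m + 2 : ℕ) : ℝ) - ((k + 1 + 1 : ℕ) : ℝ)) *
        ((ω ^ (m + 2 - (k + 1 + 1))).re - 1))).congr_left fun i => ?_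
    ring
  refine this.congr_left fun i => ?_
  rw [reLin, Finset.sum_range_succ', Finset.sum_range_succ']
  rw [re_pow_sub hω (by omega : 0 ≤ m + 2), re_pow_sub hω (by omega : 0 + 1 ≤ m + 2)]
  simp only [zero_add, pow_one, Nat.cast_zero, Nat.cast_one, sub_zero, Nat.reduceAdd]
  ring

theorem one_sub_pow_le {t : ℝ} (h0 : 0 ≤ t) (h1 : t ≤ 1) (N : ℕ) :
    (1 - t) ^ N ≤ 1 - N * t + (N * t) ^ 2 := by
  have hb : 1 + N * t ≤ (1 + t) ^ N := one_add_mul_le_pow (by linarith) N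
  have hm : (1 - t) ^ N * (1 + t) ^ N ≤ 1 := by
    rw [← mul_pow]
    exact pow_le_one₀ (by nlinarith) (by nlinarith)
  have hp : 0 ≤ (1 - t) ^ N := pow_nonneg (by linarith) N
  have h2 : (1 - t) ^ N * (1 + N * t) ≤ 1 := (mul_le_mul_of_nonneg_left hb hp).trans hm
  have hNt : 0 ≤ N * t := by positivity
  have h3 : 1 ≤ (1 - N * t + (N * t) ^ 2) * (1 + N * t) := by
    -- With `a = N t`, the product `(1 - a + a²)(1 + a)` equals `1 + a³`.
    nlinarith [pow_nonneg hNt 3]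
  exact le_of_mul_le_mul_right (h2.trans h3) (by linarith)

theorem tendsto_one_sub_sq (hr : Tendsto r l (𝓝 0)) :
    Tendsto (fun i => ((1 - r i ^ 2 : ℝ) : ℂ)) l (𝓝 1) := by
  have : Tendsto (fun i => 1 - r i ^ 2) l (𝓝 1) := by
    simpa using (hr.pow 2).const_sub 1
  simpa [Function.comp_def] using (Complex.continuous_ofReal.tendsto _).comp this

theorem one_sub_sq_sub_one_isBigO :
    (fun i => ((1 - r i ^ 2 : ℝ) : ℂ) - 1) =O[l] (fun i => r i ^ 2) := by
  refine isBigO_of_le l fun i => ?_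
  have : ((1 - r i ^ 2 : ℝ) : ℂ) - 1 = ((-(r i ^ 2) : ℝ) : ℂ) := by push_cast; ring
  rw [this, Complex.norm_real, norm_neg]

theorem isBigO_sq (hr : Tendsto r l (𝓝 0)) : (fun i => r i ^ 2) =O[l] r := by
  simpa using isBigO_pow_of_le hr (show 1 ≤ 2 by norm_num)

variable {z ζ : ι → Fin n → ℂ}

theorem revCoeff_succ_isBigO (hr : Tendsto r l (𝓝 0)) (h : ∀ j, (fun i => ζ i j) =O[l] r)
    (k : ℕ) : (fun i => revCoeff (ζ i) (k + 1)) =O[l] r := by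
  simpa using (revCoeff_isBigO h (k + 1)).trans (isBigO_pow_of_le hr (show 1 ≤ k + 1 by omega))

theorem revCoeff_one {n : ℕ} (ζ : Fin n → ℂ) : revCoeff ζ 1 = -∑ j, ζ j :=
  coeff_one_prod_one_sub _ _

theorem revCoeff_two {n : ℕ} (ζ : Fin n → ℂ) :
    revCoeff ζ 2 = ((∑ j, ζ j) ^ 2 - ∑ j, ζ j ^ 2) / 2 :=
  coeff_two_prod_one_sub _ _

theorem revCoeff_succ_isBigO_sq (hr : Tendsto r l (𝓝 0)) (h : ∀ j, (fun i => ζ i j) =O[l] r)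
    (h1 : (fun i => revCoeff (ζ i) 1) =O[l] (fun i => r i ^ 2)) (k : ℕ) :
    (fun i => revCoeff (ζ i) (k + 1)) =O[l] (fun i => r i ^ 2) := by
  rcases k with _ | k
  · exact h1
  · exact (revCoeff_isBigO h _).trans (isBigO_pow_of_le hr (by omega))

/-- The scale `g` is left free because the expansion is used twice: with `g = r`, to learn that the
first coefficient is `O(r²)`, and then with `g = r ^ 2`, where the error drops to `O(r⁴)`. -/
theorem exists_root_expansion (hn : n ≠ 0) (hr : Tendsto r l (𝓝 0))
    (h : ∀ i, CritConfig n ((1 - r i ^ 2 : ℝ) : ℂ) (z i) (ζ i)) {g : ι → ℝ}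
    (hg : (fun i => r i ^ 2) =O[l] g) (hg0 : Tendsto g l (𝓝 0))
    (hq : ∀ k, (fun i => revCoeff (ζ i) (k + 1)) =O[l] g)
    {ω : ℂ} (hω : ω ^ (n + 1) = 1) (hω1 : ω ≠ 1) :
    ∃ j : ι → Fin n, Tendsto (fun i => z i (j i)) l (𝓝 ω) ∧
      (fun i => z i (j i) ^ (n + 1) - 1) =O[l] g ∧
      (fun i => z i (j i) ^ (n + 1) - (((1 - r i ^ 2 : ℝ) : ℂ) ^ (n + 1) -
        linPart n (revCoeff (ζ i)) ω 1)) =O[l] (fun i => g i ^ 2) := by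
  have hβ := tendsto_one_sub_sq hr
  have hβ1 := (one_sub_sq_sub_one_isBigO (r := r) (l := l)).trans hg
  obtain ⟨j, hj⟩ := exists_root_tendsto hn hω hω1 h (fun k => (hq k).trans_tendsto hg0) hβ
  exact ⟨j, hj, (root_sub_isBigO hω hq hβ hβ1 hj fun i => (h i).pow_eq (j i)).1,
    root_expansion hω hq hβ hβ1 hj fun i => (h i).pow_eq (j i)⟩

/-- If all roots stay in the unit disk, the linear part cannot be too negative. -/
theorem re_linPart_ge (hn : n ≠ 0) (hr : Tendsto r l (𝓝 0))
    (h : ∀ i, CritConfig n ((1 - r i ^ 2 : ℝ) : ℂ) (z i) (ζ i)) (hz : ∀ i j, ‖z i j‖ ≤ 1)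
    {g : ι → ℝ} (hg : (fun i => r i ^ 2) =O[l] g) (hg0 : Tendsto g l (𝓝 0))
    (hq : ∀ k, (fun i => revCoeff (ζ i) (k + 1)) =O[l] g)
    {ω : ℂ} (hω : ω ^ (n + 1) = 1) (hω1 : ω ≠ 1) :
    ∃ C, ∀ᶠ i in l, -(((n : ℝ) + 1) * r i ^ 2) - C * g i ^ 2 ≤
      (linPart n (revCoeff (ζ i)) ω 1).re := by
  obtain ⟨j, -, -, hj⟩ := exists_root_expansion hn hr h hg hg0 hq hω hω1
  obtain ⟨C, hC⟩ := (isBigO_re hj).bound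
  refine ⟨C, ?_⟩
  have hr1 : ∀ᶠ i in l, r i ^ 2 < 1 := by
    have := hr.pow 2
    exact this.eventually_lt_const (by norm_num)
  filter_upwards [hC, hr1] with i hi hr1
  have h1 : (z i (j i) ^ (n + 1)).re ≤ 1 :=
    (Complex.re_le_norm _).trans (by rw [norm_pow]; exact pow_le_one₀ (norm_nonneg _) (hz _ _))
  have h2 : 1 - ((n : ℝ) + 1) * r i ^ 2 ≤ (1 - r i ^ 2) ^ (n + 1) := by
    have := one_add_mul_le_pow (a := -(r i ^ 2)) (by linarith) (n + 1)
    push_cast at this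
    rw [← sub_eq_add_neg] at this
    linarith
  rw [Real.norm_eq_abs, Real.norm_eq_abs, abs_of_nonneg (sq_nonneg (g i))] at hi
  have h3 := neg_le_of_abs_le hi
  rw [← Complex.ofReal_pow] at h3
  simp only [Complex.sub_re, Complex.ofReal_re] at h3
  linarith

end

/-! ### Upper bound: the disk condition implies approximate feasibility -/

section

variable {ι : Type*} {l : Filter ι} {r : ι → ℝ} {n : ℕ} {z ζ : ι → Fin n → ℂ}

theorem exists_pow_eq_one_im_ne_zero (hn : 2 ≤ n) : ∃ ω : ℂ, ω ^ (n + 1) = 1 ∧ ω.im ≠ 0 := by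
  have hprim := Complex.isPrimitiveRoot_exp (n + 1) (Nat.succ_ne_zero n)
  set ξ : ℂ := Complex.exp (2 * Real.pi * Complex.I / ((n + 1 : ℕ) : ℂ)) with hξ
  refine ⟨ξ, hprim.pow_eq_one, fun him => ?_⟩
  have hre : (ξ ^ 2).re = 1 := by
    have h1 : ‖ξ‖ ^ 2 = 1 := by
      rw [Complex.norm_eq_one_of_pow_eq_one hprim.pow_eq_one (Nat.succ_ne_zero n), one_pow]
    rw [← Complex.normSq_eq_norm_sq, Complex.normSq_apply, him] at h1
    rw [pow_two, Complex.mul_re, him]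
    linarith
  have him2 : (ξ ^ 2).im = 0 := by rw [pow_two, Complex.mul_im, him]; ring
  exact hprim.pow_ne_one_of_pos_of_lt (by norm_num) (by omega : 2 < n + 1)
    (Complex.ext (by simpa using hre) (by simpa using him2))

theorem re_sum_isBigO (hre : ∀ j, (fun i => (ζ i j).re) =O[l] (fun i => r i ^ 2)) :
    (fun i => (revCoeff (ζ i) 1).re) =O[l] (fun i => r i ^ 2) := by
  simp only [revCoeff_one, Complex.neg_re, Complex.re_sum]
  exact (IsBigO.fun_sum fun j _ => hre j).neg_left

/-- The sum of the critical points is of second order, although each may be of first order. -/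
theorem revCoeff_one_isBigO_sq (hn : 2 ≤ n) (hr : Tendsto r l (𝓝 0))
    (h : ∀ i, CritConfig n ((1 - r i ^ 2 : ℝ) : ℂ) (z i) (ζ i)) (hz : ∀ i j, ‖z i j‖ ≤ 1)
    (hζ : ∀ j, (fun i => ζ i j) =O[l] r)
    (hre : ∀ j, (fun i => (ζ i j).re) =O[l] (fun i => r i ^ 2)) :
    (fun i => revCoeff (ζ i) 1) =O[l] (fun i => r i ^ 2) := by
  have hn0 : n ≠ 0 := by omega
  refine isBigO_of_re_im (re_sum_isBigO hre) ?_
  -- With `g = r` the error is `O(r²)`, as are all terms except that of the imaginary part of the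
  -- first coefficient. The conjugates `ω` and `ω̄` bound it from both sides.
  have key : ∀ ω : ℂ, ω ^ (n + 1) = 1 → ω ≠ 1 →
      ∃ C, ∀ᶠ i in l, (revCoeff (ζ i) 1).im * -ω.im ≤ C * r i ^ 2 := by
    intro ω hω hω1
    obtain ⟨C, hC⟩ := re_linPart_ge hn0 hr h hz (isBigO_sq hr) hr
      (revCoeff_succ_isBigO hr hζ) hω hω1
    have hrest : (fun i => (linPart n (revCoeff (ζ i)) ω 1).re +
        ((n : ℝ) + 1) / n * ((revCoeff (ζ i) 1).im * -ω.im)) =O[l] (fun i => r i ^ 2) := by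
      obtain ⟨m, rfl⟩ := Nat.exists_eq_add_of_le' hn
      have h1 : (fun i => (∑ k ∈ Finset.range (m + 1), (((m + 2 : ℕ) : ℂ) + 1) *
          revCoeff (ζ i) (k + 1 + 1) / (((m + 2 : ℕ) : ℂ) - ((k + 1 : ℕ) : ℂ)) *
          (ω ^ (m + 2 - (k + 1)) - 1 ^ (m + 2 - (k + 1)))).re) =O[l] (fun i => r i ^ 2) := by
        refine isBigO_re (IsBigO.fun_sum fun k _ => ?_)
        refine (((revCoeff_isBigO hζ (k + 1 + 1)).trans
          (isBigO_pow_of_le hr (by omega))).const_mul_left ((((m + 2 : ℕ) : ℂ) + 1) /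
          (((m + 2 : ℕ) : ℂ) - ((k + 1 : ℕ) : ℂ)) *
            (ω ^ (m + 2 - (k + 1)) - 1 ^ (m + 2 - (k + 1))))).congr_left fun i => ?_
        ring
      have h2 := (re_sum_isBigO hre).const_mul_left
        ((((m + 2 : ℕ) : ℝ) + 1) / ((m + 2 : ℕ) : ℝ) * (ω.re - 1))
      refine (h1.add h2).congr_left fun i => ?_
      have e : ((((m + 2 : ℕ) : ℂ) + 1) * revCoeff (ζ i) (0 + 1) / (((m + 2 : ℕ) : ℂ) - (0 : ℕ)) *
          (ω ^ (m + 2 - 0) - 1 ^ (m + 2 - 0))) =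
          (((((m + 2 : ℕ) : ℝ) + 1) / ((m + 2 : ℕ) : ℝ) : ℝ) : ℂ) *
            (revCoeff (ζ i) 1 * ((starRingEnd ℂ) ω - 1)) := by
        rw [pow_sub_eq_conj hω (by omega : 0 ≤ m + 2)]
        simp only [zero_add, pow_one, one_pow, Nat.cast_zero, sub_zero]
        push_cast
        ring
      rw [linPart]
      conv_rhs => rw [Finset.sum_range_succ', Complex.add_re, e, Complex.re_ofReal_mul,
        Complex.mul_re]
      simp only [Complex.sub_re, Complex.conj_re, Complex.one_re, Complex.sub_im, Complex.conj_im,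
        Complex.one_im]
      ring
    obtain ⟨C', hC'⟩ := hrest.bound
    have hnn : (0 : ℝ) < n := by exact_mod_cast Nat.pos_of_ne_zero hn0
    refine ⟨(C' + ((n : ℝ) + 1) + C) * (n / ((n : ℝ) + 1)), ?_⟩
    filter_upwards [hC, hC'] with i h1 h2
    rw [Real.norm_eq_abs, Real.norm_eq_abs, abs_of_nonneg (sq_nonneg (r i))] at h2
    have h3 := le_of_abs_le h2
    have h4 : ((n : ℝ) + 1) / n * ((revCoeff (ζ i) 1).im * -ω.im) ≤
        (C' + ((n : ℝ) + 1) + C) * r i ^ 2 := by linarith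
    have h5 := mul_le_mul_of_nonneg_right h4 (by positivity : (0 : ℝ) ≤ n / ((n : ℝ) + 1))
    have e : ((n : ℝ) + 1) / n * ((revCoeff (ζ i) 1).im * -ω.im) * (n / ((n : ℝ) + 1)) =
        (revCoeff (ζ i) 1).im * -ω.im := by field_simp
    rw [e] at h5
    linarith
  obtain ⟨ω, hω, him⟩ := exists_pow_eq_one_im_ne_zero hn
  have hω1 : ω ≠ 1 := by rintro rfl; simp at him
  have hω1' : (starRingEnd ℂ) ω ≠ 1 := by
    intro h
    have := congrArg Complex.im h
    simp at this
    exact him this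
  obtain ⟨C, hC⟩ := key ω hω hω1
  obtain ⟨C', hC'⟩ := key _ (conj_pow_eq_one hω) hω1'
  have hprod : (fun i => (revCoeff (ζ i) 1).im * ω.im) =O[l] (fun i => r i ^ 2) := by
    refine IsBigO.of_bound (max C C') ?_
    filter_upwards [hC, hC'] with i h1 h2
    rw [Real.norm_eq_abs, Real.norm_eq_abs, abs_of_nonneg (sq_nonneg (r i)), abs_le]
    have h3 : C * r i ^ 2 ≤ max C C' * r i ^ 2 :=
      mul_le_mul_of_nonneg_right (le_max_left _ _) (sq_nonneg _)
    have h4 : C' * r i ^ 2 ≤ max C C' * r i ^ 2 :=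
      mul_le_mul_of_nonneg_right (le_max_right _ _) (sq_nonneg _)
    rw [Complex.conj_im, neg_neg] at h2
    constructor <;> linarith
  refine (hprod.const_mul_left (ω.im)⁻¹).congr_left fun i => ?_
  field_simp

/-- By Newton's identity the coefficient is half of `(∑ ζ j)² - ∑ ζ j²`; the squared sum and the
squares of the real parts are `O(r⁴)`. -/
theorem re_revCoeff_two_isBigO (h1 : (fun i => revCoeff (ζ i) 1) =O[l] (fun i => r i ^ 2))
    (hre : ∀ j, (fun i => (ζ i j).re) =O[l] (fun i => r i ^ 2)) :
    (fun i => (revCoeff (ζ i) 2).re - (∑ j, (ζ i j).im ^ 2) / 2) =O[l] (fun i => r i ^ 4) := by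
  have e4 : (fun i => (r i ^ 2) ^ 2) = fun i => r i ^ 4 := by ext; ring
  have ha : (fun i => ((revCoeff (ζ i) 1) ^ 2).re) =O[l] (fun i => r i ^ 4) :=
    isBigO_re (e4 ▸ h1.pow 2)
  have hb : (fun i => ∑ j, (ζ i j).re ^ 2) =O[l] (fun i => r i ^ 4) :=
    IsBigO.fun_sum fun j _ => e4 ▸ (hre j).pow 2
  refine ((ha.sub hb).const_mul_left (1 / 2)).congr_left fun i => ?_
  rw [revCoeff_two, revCoeff_one, neg_sq]
  have : ((∑ j, ζ i j ^ 2)).re = ∑ j, (ζ i j).re ^ 2 - ∑ j, (ζ i j).im ^ 2 := by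
    rw [Complex.re_sum, ← Finset.sum_sub_distrib]
    refine Finset.sum_congr rfl fun j _ => ?_
    rw [pow_two, Complex.mul_re]; ring
  have e2 : ((((∑ j, ζ i j) ^ 2 - ∑ j, ζ i j ^ 2) / 2 : ℂ)).re =
      (((∑ j, ζ i j) ^ 2).re - (∑ j, ζ i j ^ 2).re) / 2 := by
    rw [← Complex.sub_re, Complex.div_ofNat_re]
  rw [e2, this]
  ring

theorem eventually_feasible (hn : 2 ≤ n) (hr : Tendsto r l (𝓝 0))
    (h : ∀ i, CritConfig n ((1 - r i ^ 2 : ℝ) : ℂ) (z i) (ζ i)) (hz : ∀ i j, ‖z i j‖ ≤ 1)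
    (hζ : ∀ j, (fun i => ζ i j) =O[l] r)
    (hre : ∀ j, (fun i => (ζ i j).re) =O[l] (fun i => r i ^ 2)) :
    ∃ C, 0 ≤ C ∧ ∀ᶠ i in l, Feasible n (r i ^ 2 + C * r i ^ 4) (-∑ j, (ζ i j).re)
      ((∑ j, (ζ i j).im ^ 2) / 2) := by
  have hn0 : n ≠ 0 := by omega
  have e4 : ∀ i, (r i ^ 2) ^ 2 = r i ^ 4 := fun i => by ring
  have hq1 := revCoeff_one_isBigO_sq hn hr h hz hζ hre
  have hr2 : Tendsto (fun i => r i ^ 2) l (𝓝 0) := by simpa using hr.pow 2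
  have key : ∀ ω ∈ nthRootsFinset (n + 1) (1 : ℂ), ∃ C, ∀ᶠ i in l,
      (-∑ j, (ζ i j).re) * (1 - ω.re) / n +
        ((∑ j, (ζ i j).im ^ 2) / 2) * (1 - (ω ^ 2).re) / ((n : ℝ) - 1) ≤
      r i ^ 2 + C * r i ^ 4 := by
    intro ω hω
    rw [mem_nthRootsFinset (Nat.succ_pos n)] at hω
    rcases eq_or_ne ω 1 with rfl | hω1
    · exact ⟨0, Eventually.of_forall fun i => by simp [sq_nonneg]⟩
    have hω1' : (starRingEnd ℂ) ω ≠ 1 := by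
      intro h
      exact hω1 (by simpa using congrArg (starRingEnd ℂ) h)
    have hq := revCoeff_succ_isBigO_sq hr hζ hq1
    obtain ⟨C₁, hC₁⟩ := re_linPart_ge hn0 hr h hz (isBigO_refl _ _) hr2 hq hω hω1
    obtain ⟨C₂, hC₂⟩ := re_linPart_ge hn0 hr h hz (isBigO_refl _ _) hr2 hq
      (conj_pow_eq_one hω) hω1'
    obtain ⟨C₃, hC₃⟩ := (reLin_sub_isBigO hn hω
      (fun k hk => re_revCoeff_isBigO hr hζ hre hk)).bound
    obtain ⟨C₄, hC₄⟩ := ((re_revCoeff_two_isBigO hq1 hre).const_mul_left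
      ((1 - (ω ^ 2).re) / ((n : ℝ) - 1))).bound
    refine ⟨(C₁ / 2 + C₂ / 2 + C₃) / ((n : ℝ) + 1) + C₄, ?_⟩
    filter_upwards [hC₁, hC₂, hC₃, hC₄] with i h1 h2 h3 h4
    have hr4 : 0 ≤ r i ^ 4 := by positivity
    rw [Real.norm_eq_abs, Real.norm_eq_abs, abs_of_nonneg hr4] at h3 h4
    have h12 : -(((n : ℝ) + 1) * r i ^ 2) - (C₁ / 2 + C₂ / 2) * r i ^ 4 ≤
        reLin n (revCoeff (ζ i)) ω := by
      rw [e4] at h1 h2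
      have := re_linPart_add_conj n (revCoeff (ζ i)) ω
      linarith
    have h3' := le_of_abs_le h3
    have h4' := neg_le_of_abs_le h4
    have hnn : (0 : ℝ) < (n : ℝ) + 1 := by positivity
    have e1 : (revCoeff (ζ i) 1).re = -∑ j, (ζ i j).re := by
      rw [revCoeff_one, Complex.neg_re, Complex.re_sum]
    rw [e1] at h3'
    have h5 : (-∑ j, (ζ i j).re) * (1 - ω.re) / n +
        (revCoeff (ζ i) 2).re * (1 - (ω ^ 2).re) / ((n : ℝ) - 1) ≤
        r i ^ 2 + (C₁ / 2 + C₂ / 2 + C₃) / ((n : ℝ) + 1) * r i ^ 4 := by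
      refine le_of_mul_le_mul_left (le_trans (b := ((n : ℝ) + 1) * r i ^ 2 +
        (C₁ / 2 + C₂ / 2 + C₃) * r i ^ 4) (by linarith) (le_of_eq ?_)) hnn
      field_simp
    have e5 : (1 - (ω ^ 2).re) / ((n : ℝ) - 1) *
        ((revCoeff (ζ i) 2).re - (∑ j, (ζ i j).im ^ 2) / 2) =
        (revCoeff (ζ i) 2).re * (1 - (ω ^ 2).re) / ((n : ℝ) - 1) -
        ((∑ j, (ζ i j).im ^ 2) / 2) * (1 - (ω ^ 2).re) / ((n : ℝ) - 1) := by ring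
    rw [e5] at h4'
    linarith
  obtain ⟨C, hC0, hC⟩ := exists_uniform_const (nthRootsFinset (n + 1) (1 : ℂ))
    (fun ω C i => (-∑ j, (ζ i j).re) * (1 - ω.re) / n +
        ((∑ j, (ζ i j).im ^ 2) / 2) * (1 - (ω ^ 2).re) / ((n : ℝ) - 1) ≤
      r i ^ 2 + C * r i ^ 4)
    (fun ω C C' i hCC hle => hle.trans (by gcongr)) key
  refine ⟨C, hC0, hC.mono fun i hi => ⟨by positivity, fun ω hω => hi ω ?_⟩⟩
  rwa [mem_nthRootsFinset (Nat.succ_pos n)]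

/-- From `√(u² + v²) ≤ u + v²/(2u)`, where replacing `u` by `1` in the denominator costs `O(ε²)`. -/
theorem le_of_le_norm_sub {ε ρ D : ℝ} {w : ℂ} (hD : 0 ≤ D) (hε0 : 0 ≤ ε)
    (hε : (1 + D) * ε ≤ 1 / 2) (hre : |w.re| ≤ D * ε) (him : w.im ^ 2 ≤ D * ε)
    (hρ : ρ ≤ ‖((1 - ε : ℝ) : ℂ) - w‖) :
    ρ ≤ 1 - ε - w.re + w.im ^ 2 / 2 + D * (1 + D) * ε ^ 2 := by
  obtain ⟨h1, h2⟩ := abs_le.1 hre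
  set u := 1 - ε - w.re with hu
  have hu1 : 1 - u ≤ (1 + D) * ε := by rw [hu]; linarith
  have hu2 : 1 / 2 ≤ u := by linarith
  have hv := sq_nonneg w.im
  refine hρ.trans ?_
  have hn : ‖((1 - ε : ℝ) : ℂ) - w‖ ^ 2 = u ^ 2 + w.im ^ 2 := by
    rw [← Complex.normSq_eq_norm_sq, Complex.normSq_apply]
    simp [hu]; ring
  have hle : ‖((1 - ε : ℝ) : ℂ) - w‖ ≤ u + w.im ^ 2 / (2 * u) := by
    refine abs_le_of_sq_le_sq' ?_ (by positivity) |>.2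
    rw [hn]
    have e : (u + w.im ^ 2 / (2 * u)) ^ 2 = u ^ 2 + w.im ^ 2 + (w.im ^ 2 / (2 * u)) ^ 2 := by
      have : u ≠ 0 := by linarith
      field_simp; ring
    rw [e]; linarith [sq_nonneg (w.im ^ 2 / (2 * u))]
  refine hle.trans ?_
  have : w.im ^ 2 / (2 * u) ≤ w.im ^ 2 / 2 + D * (1 + D) * ε ^ 2 := by
    rw [div_le_iff₀ (by linarith)]
    have hDε : 0 ≤ D * ε := by positivity
    have h3 : w.im ^ 2 * (1 - u) ≤ (D * ε) * ((1 + D) * ε) := by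
      rcases le_total 0 (1 - u) with h0 | h0
      · exact mul_le_mul him hu1 h0 hDε
      · exact (mul_nonpos_of_nonneg_of_nonpos hv h0).trans (by positivity)
    have h4 : 0 ≤ D * (1 + D) * ε ^ 2 := by positivity
    nlinarith
  linarith

theorem upper_asymptotics (hn : 2 ≤ n) (hr : Tendsto r l (𝓝 0))
    (h : ∀ i, CritConfig n ((1 - r i ^ 2 : ℝ) : ℂ) (z i) (ζ i)) (hz : ∀ i j, ‖z i j‖ ≤ 1)
    {ρ : ι → ℝ} (hρ1 : ∀ i, 1 - r i ^ 2 ≤ ρ i)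
    (hρ : ∀ i j, ρ i ≤ ‖((1 - r i ^ 2 : ℝ) : ℂ) - ζ i j‖) :
    ∃ C, ∀ᶠ i in l, ρ i ≤ 1 - (1 - lpValue n / n) * r i ^ 2 + C * r i ^ 4 := by
  obtain ⟨D, hD0, hD⟩ := CritConfig.crit_bound n
  have hr2 : Tendsto (fun i => r i ^ 2) l (𝓝 0) := by simpa using hr.pow 2
  have hsmall : ∀ᶠ i in l, (1 + D) * r i ^ 2 ≤ 1 / 2 := by
    have := hr2.const_mul (1 + D)
    rw [mul_zero] at this
    exact (this.eventually_lt_const (by norm_num : (0 : ℝ) < 1 / 2)).mono fun i hi => hi.le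
  have hbd : ∀ᶠ i in l, ∀ j, |(ζ i j).re| ≤ D * r i ^ 2 ∧ (ζ i j).im ^ 2 ≤ D * r i ^ 2 := by
    filter_upwards [hsmall] with i hi
    exact hD _ _ _ (sq_nonneg _) (by nlinarith [sq_nonneg (r i)]) (h i) (hz i)
      fun j => (hρ1 i).trans (hρ i j)
  have hre : ∀ j, (fun i => (ζ i j).re) =O[l] (fun i => r i ^ 2) := by
    intro j
    refine IsBigO.of_bound D (hbd.mono fun i hi => ?_)
    rw [Real.norm_eq_abs, Real.norm_eq_abs, abs_of_nonneg (sq_nonneg (r i))]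
    exact (hi j).1
  have him : ∀ j, (fun i => (ζ i j).im) =O[l] r := by
    intro j
    refine IsBigO.of_bound (Real.sqrt D) (hbd.mono fun i hi => ?_)
    rw [Real.norm_eq_abs, Real.norm_eq_abs]
    refine abs_le_of_sq_le_sq' ?_ (by positivity) |>.2
    rw [sq_abs, mul_pow, sq_abs, Real.sq_sqrt hD0.le]
    exact (hi j).2
  have hζ : ∀ j, (fun i => ζ i j) =O[l] r :=
    fun j => isBigO_of_re_im ((hre j).trans (isBigO_sq hr)) (him j)
  obtain ⟨C, hC0, hC⟩ := eventually_feasible hn hr h hz hζ hre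
  have hnn : (0 : ℝ) < n := by exact_mod_cast (by omega : 0 < n)
  refine ⟨lpValue n * C / n + D * (1 + D), ?_⟩
  filter_upwards [hC, hbd, hsmall] with i hf hb hs
  have h1 := hf.le_lpValue hn (by positivity)
  -- The least distance is compared with the mean, so only `∑ Re ζ j` and `∑ (Im ζ j)²` enter.
  have h2 : ∑ _j : Fin n, ρ i ≤ ∑ j : Fin n, (1 - r i ^ 2 - (ζ i j).re + (ζ i j).im ^ 2 / 2 +
      D * (1 + D) * (r i ^ 2) ^ 2) :=
    Finset.sum_le_sum fun j _ => le_of_le_norm_sub hD0.le (sq_nonneg _) hs (hb j).1 (hb j).2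
      (hρ i j)
  simp only [Finset.sum_add_distrib, Finset.sum_sub_distrib, Finset.sum_const, Finset.card_univ,
    Fintype.card_fin, nsmul_eq_mul, ← Finset.sum_div] at h2
  refine le_of_mul_le_mul_left (h2.trans ?_) hnn
  have e : (n : ℝ) * (1 - (1 - lpValue n / n) * r i ^ 2 +
      (lpValue n * C / n + D * (1 + D)) * r i ^ 4) =
      n - n * r i ^ 2 + lpValue n * (r i ^ 2 + C * r i ^ 4) + n * (D * (1 + D) * r i ^ 4) := by
    field_simp
    ring
  rw [e]
  have e4 : (r i ^ 2) ^ 2 = r i ^ 4 := by ring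
  rw [e4]
  linarith

end

/-! ### Lower bound: extremal configurations -/

/-- The critical points `x ± i y` and `c` (with multiplicity `m`). -/
noncomputable def testCrit (m : ℕ) (x y c : ℝ) : Fin (m + 2) → ℂ :=
  Fin.cons ⟨x, y⟩ (Fin.cons ⟨x, -y⟩ fun _ => (c : ℂ))

theorem sum_testCrit {m : ℕ} {x y c : ℝ} {M : Type*} [AddCommMonoid M] (F : ℂ → M) :
    ∑ j, F (testCrit m x y c j) = F ⟨x, y⟩ + (F ⟨x, -y⟩ + m • F c) := by
  simp [testCrit, Fin.sum_univ_succ]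

theorem forall_testCrit {m : ℕ} {x y c : ℝ} {p : ℂ → Prop} (h₁ : p ⟨x, y⟩) (h₂ : p ⟨x, -y⟩)
    (h₃ : p c) (j : Fin (m + 2)) : p (testCrit m x y c j) := by
  refine Fin.cases h₁ (fun j => ?_) j
  refine Fin.cases h₂ (fun j => ?_) j
  exact h₃

/-- The critical points are symmetric under conjugation. With real coefficients each single root
obeys the averaged inequality, so feasibility becomes sufficient. -/
theorem im_revCoeff_testCrit (m : ℕ) (x y c : ℝ) (k : ℕ) :
    (revCoeff (testCrit m x y c) k).im = 0 := by
  have : ∏ j, (1 - C (testCrit m x y c j) * X) =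
      ((1 - C (2 * x) * X + C (x ^ 2 + y ^ 2) * X ^ 2) * (1 - C c * X) ^ m : ℝ[X]).map
        Complex.ofRealHom := by
    have e : (1 - C (⟨x, y⟩ : ℂ) * X) * (1 - C (⟨x, -y⟩ : ℂ) * X) =
        1 - C (2 * (x : ℂ)) * X + C ((x : ℂ) ^ 2 + (y : ℂ) ^ 2) * X ^ 2 := by
      have h1 : 2 * (x : ℂ) = ⟨x, y⟩ + ⟨x, -y⟩ := by
        apply Complex.ext <;> simp; ring
      have h2 : (x : ℂ) ^ 2 + (y : ℂ) ^ 2 = ⟨x, y⟩ * ⟨x, -y⟩ := by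
        apply Complex.ext <;> simp [pow_two]; ring
      rw [h1, h2, C_add, C_mul]
      ring
    rw [Fin.prod_univ_succ, Fin.prod_univ_succ]
    simp only [testCrit, Fin.cons_zero, Fin.cons_succ, Finset.prod_const, Finset.card_univ,
      Fintype.card_fin]
    rw [← mul_assoc, e]
    simp
  rw [revCoeff, this, coeff_map]
  simp

section

variable {ι : Type*} {l : Filter ι} {r : ι → ℝ} {n : ℕ} {z ζ : ι → Fin n → ℂ}

theorem one_sub_sq_pow_sub_isBigO (hr : Tendsto r l (𝓝 0)) (N : ℕ) :
    ∃ C, ∀ᶠ i in l, (1 - r i ^ 2) ^ N ≤ 1 - N * r i ^ 2 + C * r i ^ 4 := by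
  refine ⟨N ^ 2, ?_⟩
  have hr2 : Tendsto (fun i => r i ^ 2) l (𝓝 0) := by simpa using hr.pow 2
  filter_upwards [hr2.eventually_lt_const one_pos] with i hi
  refine (one_sub_pow_le (sq_nonneg (r i)) hi.le N).trans (le_of_eq ?_)
  ring

/-- Put `a = C² ε²`. The slack `t` gives `0 ≤ Re x ^ N ≤ 1 - a`, so `|x ^ N|² ≤ (1 - a)² + a ≤ 1`.
-/
theorem norm_le_one_of_re_im {x : ℂ} {N : ℕ} {C t ε : ℝ} (hN : 1 ≤ N) (hC : 0 ≤ C)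
    (h0 : 0 ≤ (x ^ N).re) (hre : (x ^ N).re ≤ 1 - N * t + C * ε ^ 2)
    (him : |(x ^ N).im| ≤ C * ε) (ht : (C + C ^ 2) * ε ^ 2 ≤ t) : ‖x‖ ≤ 1 := by
  have hN' : (1 : ℝ) ≤ N := by exact_mod_cast hN
  have h1 : (x ^ N).re ≤ 1 - C ^ 2 * ε ^ 2 := by
    have : 0 ≤ t := le_trans (by positivity) ht
    nlinarith
  have h2 : (x ^ N).im ^ 2 ≤ C ^ 2 * ε ^ 2 := by
    rw [← sq_abs, ← mul_pow]
    exact pow_le_pow_left₀ (abs_nonneg _) him 2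
  have h3 : ‖x ^ N‖ ^ 2 ≤ 1 := by
    rw [← Complex.normSq_eq_norm_sq, Complex.normSq_apply]
    nlinarith [sq_nonneg (C * ε)]
  have h4 : ‖x‖ ^ N ≤ 1 := by
    rw [← norm_pow]
    exact (sq_le_one_iff₀ (norm_nonneg _)).1 h3
  exact (pow_le_one_iff_of_nonneg (norm_nonneg _) (by omega)).1 h4

/-- Roots with different limits are eventually different, and there are `n` nontrivial roots of
unity for `n` indices; so control near each `ω` controls every root. -/
theorem eventually_surjective_of_tendsto
    {j : ℂ → ι → Fin n}
    (h : ∀ ω : ℂ, ω ^ (n + 1) = 1 → ω ≠ 1 → Tendsto (fun i => z i (j ω i)) l (𝓝 ω)) :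
    ∀ᶠ i in l, ∀ k : Fin n, ∃ ω ∈ (nthRootsFinset (n + 1) (1 : ℂ)).erase 1, j ω i = k := by
  classical
  set T := (nthRootsFinset (n + 1) (1 : ℂ)).erase 1 with hT
  have hmem : ∀ ω ∈ T, ω ^ (n + 1) = 1 ∧ ω ≠ 1 := by
    intro ω hω
    rw [hT, Finset.mem_erase, mem_nthRootsFinset (Nat.succ_pos n)] at hω
    exact hω.symm
  have hcard : T.card = n := by
    rw [hT, Finset.card_erase_of_mem ((mem_nthRootsFinset (Nat.succ_pos n) 1).2 (one_pow _)),
      (Complex.isPrimitiveRoot_exp (n + 1) (Nat.succ_ne_zero n)).card_nthRootsFinset,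
      Nat.add_sub_cancel]
  have hinj : ∀ᶠ i in l, ∀ ω ∈ T, ∀ ω' ∈ T, ω ≠ ω' → z i (j ω i) ≠ z i (j ω' i) := by
    rw [eventually_all_finset]
    intro ω hω
    rw [eventually_all_finset]
    intro ω' hω'
    by_cases hne : ω = ω'
    · simp [hne]
    · filter_upwards [((h ω (hmem ω hω).1 (hmem ω hω).2).sub
        (h ω' (hmem ω' hω').1 (hmem ω' hω').2)).eventually_ne (sub_ne_zero.2 hne)] with i hi _
      exact sub_ne_zero.1 hi
  filter_upwards [hinj] with i hi k
  have himg : T.image (fun ω => j ω i) = Finset.univ := by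
    apply Finset.eq_univ_of_card
    rw [Finset.card_image_of_injOn, hcard, Fintype.card_fin]
    intro ω hω ω' hω' he
    by_contra hne
    exact hi ω hω ω' hω' hne (congrArg (z i) he)
  have := Finset.mem_univ k
  rw [← himg, Finset.mem_image] at this
  exact this

/-- If the critical points come from a feasible point scaled by `s ≤ ε`, all roots are in the
unit disk as soon as `ε - s` is at least a constant times `ε ^ 2`. -/
theorem roots_in_disk (hn : 2 ≤ n) (hr : Tendsto r l (𝓝 0)) {A w : ℝ} (hf : Feasible n 1 A w)
    {s : ι → ℝ} (hs0 : ∀ i, 0 ≤ s i)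
    (h : ∀ i, CritConfig n ((1 - r i ^ 2 : ℝ) : ℂ) (z i) (ζ i))
    (hζ : ∀ j, (fun i => ζ i j) =O[l] r)
    (hre : ∀ j, (fun i => (ζ i j).re) =O[l] (fun i => r i ^ 2))
    (him : ∀ i k, (revCoeff (ζ i) k).im = 0)
    (hA : ∀ i, (revCoeff (ζ i) 1).re = A * s i)
    (hw : ∀ i, (∑ j, (ζ i j).im ^ 2) / 2 = w * s i) :
    ∃ C, 0 ≤ C ∧ ∀ᶠ i in l, C * r i ^ 4 ≤ r i ^ 2 - s i → ∀ k, ‖z i k‖ ≤ 1 := by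
  have hn0 : n ≠ 0 := by omega
  have e4 : ∀ i, (r i ^ 2) ^ 2 = r i ^ 4 := fun i => by ring
  have hr2 : Tendsto (fun i => r i ^ 2) l (𝓝 0) := by simpa using hr.pow 2
  have hq1 : (fun i => revCoeff (ζ i) 1) =O[l] (fun i => r i ^ 2) :=
    isBigO_of_re_im (re_sum_isBigO hre) (by simpa [him] using isBigO_zero _ l)
  have hq := revCoeff_succ_isBigO_sq hr hζ hq1
  have hex : ∀ ω : ℂ, ∃ j : ι → Fin n, ω ^ (n + 1) = 1 → ω ≠ 1 →
      Tendsto (fun i => z i (j i)) l (𝓝 ω) ∧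
      (fun i => z i (j i) ^ (n + 1) - 1) =O[l] (fun i => r i ^ 2) ∧
      (fun i => z i (j i) ^ (n + 1) - (((1 - r i ^ 2 : ℝ) : ℂ) ^ (n + 1) -
        linPart n (revCoeff (ζ i)) ω 1)) =O[l] (fun i => (r i ^ 2) ^ 2) := by
    intro ω
    by_cases hω : ω ^ (n + 1) = 1 ∧ ω ≠ 1
    · obtain ⟨j, hj⟩ := exists_root_expansion hn0 hr h (isBigO_refl _ _) hr2 hq hω.1 hω.2
      exact ⟨j, fun _ _ => hj⟩
    -- An arbitrary index for irrelevant `ω`, so that `choose` yields a function on all of `ℂ`.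
    · exact ⟨fun _ => ⟨0, Nat.pos_of_ne_zero hn0⟩, fun h1 h2 => absurd ⟨h1, h2⟩ hω⟩
  choose j hj using hex
  have hmem : ∀ ω ∈ (nthRootsFinset (n + 1) (1 : ℂ)).erase 1, ω ^ (n + 1) = 1 ∧ ω ≠ 1 := by
    intro ω hω
    rw [Finset.mem_erase, mem_nthRootsFinset (Nat.succ_pos n)] at hω
    exact hω.symm
  have key : ∀ ω ∈ (nthRootsFinset (n + 1) (1 : ℂ)).erase 1, ∃ C, ∀ᶠ i in l,
      C * r i ^ 4 ≤ r i ^ 2 - s i → ‖z i (j ω i)‖ ≤ 1 := by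
    intro ω hω
    obtain ⟨hω, hω1⟩ := hmem ω hω
    obtain ⟨hj1, hj2, hj3⟩ := hj ω hω hω1
    obtain ⟨C₁, hC₁⟩ := (isBigO_im hj2).bound
    obtain ⟨C₂, hC₂⟩ := (isBigO_re hj3).bound
    obtain ⟨C₃, hC₃⟩ := (reLin_sub_isBigO hn hω
      (fun k hk => re_revCoeff_isBigO hr hζ hre hk)).bound
    obtain ⟨C₄, hC₄⟩ := ((re_revCoeff_two_isBigO hq1 hre).const_mul_left
      (((n : ℝ) + 1) * ((1 - (ω ^ 2).re) / ((n : ℝ) - 1)))).bound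
    obtain ⟨C₅, hC₅⟩ := one_sub_sq_pow_sub_isBigO hr (n + 1)
    have hpos : ∀ᶠ i in l, 0 < (z i (j ω i) ^ (n + 1)).re := by
      have := (Complex.continuous_re.tendsto _).comp (hj1.pow (n + 1))
      rw [hω] at this
      exact this.eventually_const_lt (by simp)
    set K := |C₁| + |C₂ + C₃ + C₄ + C₅| with hK
    have hK0 : 0 ≤ K := by positivity
    refine ⟨K + K ^ 2, ?_⟩
    filter_upwards [hC₁, hC₂, hC₃, hC₄, hC₅, hpos] with i h1 h2 h3 h4 h5 h6 hle
    have hr4 : 0 ≤ r i ^ 4 := by positivity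
    rw [e4, Real.norm_eq_abs, Real.norm_eq_abs, abs_of_nonneg hr4] at h2
    rw [Real.norm_eq_abs, Real.norm_eq_abs, abs_of_nonneg hr4] at h3 h4
    rw [Real.norm_eq_abs, Real.norm_eq_abs, abs_of_nonneg (sq_nonneg (r i))] at h1
    refine norm_le_one_of_re_im (N := n + 1) (C := K) (t := r i ^ 2 - s i) (ε := r i ^ 2)
      (by omega) hK0 h6.le ?_ ?_ (by rwa [e4])
    · have h2' := le_of_abs_le h2
      have h3' := neg_le_of_abs_le h3
      have h4' := le_of_abs_le h4
      rw [← Complex.ofReal_pow] at h2'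
      simp only [Complex.sub_re, Complex.ofReal_re] at h2'
      rw [re_linPart_of_real _ _ _ (him i)] at h2'
      rw [hA i] at h3'
      rw [hw i] at h4'
      have hfe := mul_le_mul_of_nonneg_left (mul_le_mul_of_nonneg_right (hf.2 ω hω) (hs0 i))
        (by positivity : (0 : ℝ) ≤ (n : ℝ) + 1)
      have hKle : (C₂ + C₃ + C₄ + C₅) * r i ^ 4 ≤ K * r i ^ 4 :=
        mul_le_mul_of_nonneg_right
          ((le_abs_self _).trans (by rw [hK]; linarith [abs_nonneg C₁])) hr4
      rw [e4]
      push_cast at h5 ⊢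
      have e5 : ((n : ℝ) + 1) * ((1 - (ω ^ 2).re) / ((n : ℝ) - 1)) *
          ((revCoeff (ζ i) 2).re - w * s i) =
          ((n : ℝ) + 1) * ((revCoeff (ζ i) 2).re * (1 - (ω ^ 2).re) / ((n : ℝ) - 1)) -
          ((n : ℝ) + 1) * (w * (1 - (ω ^ 2).re) / ((n : ℝ) - 1) * s i) := by ring
      have e6 : A * s i * (1 - ω.re) / n = A * (1 - ω.re) / n * s i := by ring
      rw [e5] at h4'
      rw [e6] at h3'
      linarith
    · simp only [Complex.sub_im, Complex.one_im, sub_zero] at h1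
      refine h1.trans (mul_le_mul_of_nonneg_right ?_ (sq_nonneg _))
      exact (le_abs_self _).trans (by rw [hK]; linarith [abs_nonneg (C₂ + C₃ + C₄ + C₅)])
  obtain ⟨C, hC0, hC⟩ := exists_uniform_const ((nthRootsFinset (n + 1) (1 : ℂ)).erase 1)
    (fun ω C i => C * r i ^ 4 ≤ r i ^ 2 - s i → ‖z i (j ω i)‖ ≤ 1)
    (fun ω C C' i hCC hle h => hle (le_trans (by gcongr) h)) key
  refine ⟨C, hC0, ?_⟩
  filter_upwards [hC, eventually_surjective_of_tendsto fun ω h1 h2 => (hj ω h1 h2).1]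
    with i h1 h2 h3 k
  obtain ⟨ω, hω, rfl⟩ := h2 k
  exact h1 ω hω h3

end

/-- For the conjugate pair the squared distance is `(b + a)² + w s (1 - b - a) + (w s)²/4`; the real
point is at distance `b + a` when that is nonnegative. -/
theorem le_norm_sub_testCrit {m : ℕ} {b w s a : ℝ} (hw : 0 ≤ w * s) (hb1 : b + a ≤ 1) (j : Fin (m + 2)) :
    b + a ≤ ‖(b : ℂ) - testCrit m (w * s / 2 - a) (Real.sqrt (w * s)) (-a) j‖ := by
  have key : ∀ y : ℝ, y ^ 2 = w * s → b + a ≤ ‖(b : ℂ) - ⟨w * s / 2 - a, y⟩‖ := by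
    intro y hy
    refine abs_le_of_sq_le_sq' ?_ (norm_nonneg _) |>.2
    rw [← Complex.normSq_eq_norm_sq, Complex.normSq_apply]
    simp only [Complex.sub_re, Complex.ofReal_re, Complex.sub_im, Complex.ofReal_im]
    nlinarith [sq_nonneg (w * s), mul_nonneg hw (sub_nonneg.2 hb1)]
  refine forall_testCrit (p := fun ζ => b + a ≤ ‖(b : ℂ) - ζ‖) (key _ (Real.sq_sqrt hw))
    (key _ (by rw [neg_sq]; exact Real.sq_sqrt hw)) ?_ j
  rw [← Complex.ofReal_sub, Complex.norm_real, sub_neg_eq_add]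
  exact le_abs_self _

theorem lower_configurations {n : ℕ} (hn : 2 ≤ n) :
    ∃ C, 0 ≤ C ∧ ∀ᶠ ε in 𝓝[≥] (0 : ℝ), ∀ s, 0 ≤ s → s ≤ ε → C * ε ^ 2 ≤ ε - s →
      ∃ z ζ : Fin n → ℂ, CritConfig n ((1 - ε : ℝ) : ℂ) z ζ ∧ (∀ j, ‖z j‖ ≤ 1) ∧
        ∀ j, 1 - ε + lpValue n / n * s ≤ ‖((1 - ε : ℝ) : ℂ) - ζ j‖ := by
  obtain ⟨A, w, hf, hL⟩ := (isGreatest_lpValue hn).1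
  have hL0 := lpValue_nonneg hn
  have hL1 := lpValue_lt hn
  obtain ⟨m, rfl⟩ := Nat.exists_eq_add_of_le' hn
  set L := lpValue (m + 2) / ((m + 2 : ℕ) : ℝ) with hLdef
  have hm0 : (0 : ℝ) < ((m + 2 : ℕ) : ℝ) := by positivity
  have hLn : 0 ≤ L := by positivity
  have hLle : L ≤ 1 := by rw [hLdef, div_le_one hm0]; exact hL1.le
  -- Indexing by all pairs `(ε, s)` makes the constant uniform in `s`, which may therefore be chosen
  -- afterwards in terms of that constant.
  let ι := {p : ℝ × ℝ // 0 ≤ p.2 ∧ p.2 ≤ p.1}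
  let ε : ι → ℝ := fun p => p.1.1
  let s : ι → ℝ := fun p => p.1.2
  have hs0 : ∀ i, 0 ≤ s i := fun i => i.2.1
  have hsε : ∀ i, s i ≤ ε i := fun i => i.2.2
  have hε0 : ∀ i, 0 ≤ ε i := fun i => (hs0 i).trans (hsε i)
  let l : Filter ι := comap ε (𝓝 0)
  have hεl : Tendsto ε l (𝓝 0) := tendsto_comap
  let r : ι → ℝ := fun i => Real.sqrt (ε i)
  have hr2 : ∀ i, r i ^ 2 = ε i := fun i => Real.sq_sqrt (hε0 i)
  have hr : Tendsto r l (𝓝 0) := by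
    have := (Real.continuous_sqrt.tendsto 0).comp hεl
    rwa [Real.sqrt_zero] at this
  -- The imaginary parts produce `w s`. The common shift `-L s`, with `n L = A + w`, then makes the
  -- real parts sum to `-A s`.
  let ζ : ι → Fin (m + 2) → ℂ := fun i =>
    testCrit m (w * s i / 2 - L * s i) (Real.sqrt (w * s i)) (-(L * s i))
  choose z hz using fun i => exists_roots_of_crit ((1 - r i ^ 2 : ℝ) : ℂ) (ζ i)
  have hws : ∀ i, 0 ≤ w * s i := fun i => mul_nonneg hf.1 (hs0 i)
  have hsO : s =O[l] (fun i => r i ^ 2) := by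
    refine isBigO_of_le l fun i => ?_
    rw [Real.norm_of_nonneg (hs0 i), Real.norm_of_nonneg (sq_nonneg _), hr2]
    exact hsε i
  have hre : ∀ j, (fun i => (ζ i j).re) =O[l] (fun i => r i ^ 2) := by
    intro j
    have h1 : (fun i => w * s i / 2 - L * s i) =O[l] (fun i => r i ^ 2) :=
      (hsO.const_mul_left (w / 2 - L)).congr_left fun i => by ring
    have h2 : (fun i => -(L * s i)) =O[l] (fun i => r i ^ 2) :=
      (hsO.const_mul_left (-L)).congr_left fun i => by ring
    refine Fin.cases h1 (fun j => ?_) j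
    refine Fin.cases h1 (fun j => ?_) j
    exact h2
  have hy : (fun i => Real.sqrt (w * s i)) =O[l] r := by
    refine IsBigO.of_bound (Real.sqrt w) (Eventually.of_forall fun i => ?_)
    rw [Real.norm_of_nonneg (Real.sqrt_nonneg _), Real.norm_of_nonneg (Real.sqrt_nonneg _),
      Real.sqrt_mul hf.1]
    exact mul_le_mul_of_nonneg_left (Real.sqrt_le_sqrt (hsε i)) (Real.sqrt_nonneg _)
  have him : ∀ j, (fun i => (ζ i j).im) =O[l] r := by
    intro j
    refine Fin.cases hy (fun j => ?_) j
    refine Fin.cases hy.neg_left (fun j => ?_) j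
    exact isBigO_zero _ l
  have hζ : ∀ j, (fun i => ζ i j) =O[l] r :=
    fun j => isBigO_of_re_im ((hre j).trans (isBigO_sq hr)) (him j)
  have hA : ∀ i, (revCoeff (ζ i) 1).re = A * s i := by
    intro i
    rw [revCoeff_one, Complex.neg_re, Complex.re_sum, sum_testCrit]
    have : L * ((m : ℝ) + 2) = A + w := by
      rw [hL, hLdef]; push_cast; field_simp
    simp only [Complex.ofReal_re, nsmul_eq_mul]
    linear_combination s i * this
  have hw : ∀ i, (∑ j, (ζ i j).im ^ 2) / 2 = w * s i := by
    intro i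
    rw [sum_testCrit fun x => x.im ^ 2]
    simp only [Complex.ofReal_im, neg_sq, Real.sq_sqrt (hws i)]
    simp
  obtain ⟨C, hC0, hC⟩ := roots_in_disk hn hr hf hs0 hz hζ hre
    (fun i k => im_revCoeff_testCrit _ _ _ _ _) hA hw
  refine ⟨C, hC0, ?_⟩
  rw [eventually_comap] at hC
  filter_upwards [nhdsWithin_le_nhds hC, nhdsWithin_le_nhds (Iic_mem_nhds one_pos)]
    with e he he1 t ht0 hte hCt
  let i : ι := ⟨(e, t), ht0, hte⟩
  have hri : r i ^ 2 = e := hr2 i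
  have := he i rfl (by
    have e4 : r i ^ 4 = (r i ^ 2) ^ 2 := by ring
    rw [e4, hri]; exact hCt)
  have hcfg := hz i
  rw [hri] at hcfg
  refine ⟨z i, ζ i, hcfg, this, ?_⟩
  have h1 : L * t ≤ e := by nlinarith
  exact le_norm_sub_testCrit (hws i) (by linarith)

/-! ### Two-sided estimates for the Sendov radius -/

theorem CritConfig.le_two_of_forall_le {n : ℕ} (hn : n ≠ 0) {β : ℂ} {z ζ : Fin n → ℂ} {ρ : ℝ}
    (h : CritConfig n β z ζ) (hβ : ‖β‖ ≤ 1) (hz : ∀ j, ‖z j‖ ≤ 1)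
    (hρ : ∀ j, ρ ≤ ‖β - ζ j‖) : ρ ≤ 2 := by
  by_contra! hcon
  have h1 : ρ ^ n ≤ ∏ j, ‖β - ζ j‖ := by
    have := Finset.prod_le_prod (s := (Finset.univ : Finset (Fin n))) (f := fun _ => ρ)
      (g := fun j => ‖β - ζ j‖) (fun _ _ => by linarith) (fun j _ => hρ j)
    simpa using this
  have h2 : ∏ j, ‖β - z j‖ ≤ 2 ^ n := by
    have := Finset.prod_le_prod (s := (Finset.univ : Finset (Fin n))) (f := fun j => ‖β - z j‖)
      (g := fun _ => (2 : ℝ)) (fun _ _ => norm_nonneg _)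
      (fun j _ => (norm_sub_le _ _).trans (by linarith [hz j]))
    simpa using this
  have h3 := congrArg norm h.prod_eq
  rw [norm_mul, norm_prod, norm_prod] at h3
  have h5 : (1 : ℝ) ≤ ‖(n : ℂ) + 1‖ := by
    rw [← Nat.cast_succ, Complex.norm_natCast]
    exact_mod_cast Nat.succ_pos n
  have h6 : (2 : ℝ) ^ n < ρ ^ n := pow_lt_pow_left₀ hcon (by norm_num) hn
  have h7 := mul_le_mul_of_nonneg_right h5
    (Finset.prod_nonneg fun j (_ : j ∈ Finset.univ) => norm_nonneg (β - ζ j))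
  linarith

theorem criticalDist_le {n : ℕ} {β : ℂ} {P : ℂ[X]} {ζ : Fin n → ℂ}
    (h : {x | P.derivative.IsRoot x} = Set.range ζ) (j : Fin n) :
    criticalDist P β ≤ ‖β - ζ j‖ := by
  rw [criticalDist, h, ← dist_eq_norm]
  exact Metric.infDist_le_dist_of_mem ⟨j, rfl⟩

/-- Without boundedness `sSup` would take its default value `0`. -/
theorem bddAbove_criticalDist {n : ℕ} (hn : n ≠ 0) {β : ℂ} (hβ : ‖β‖ ≤ 1) :
    BddAbove ((fun P : ℂ[X] => criticalDist P β) '' sendovClass (n + 1) β) := by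
  refine ⟨2, ?_⟩
  rintro _ ⟨P, hP, rfl⟩
  obtain ⟨z, ζ, h, hz, hr⟩ := exists_critConfig hP
  exact h.le_two_of_forall_le hn hβ hz (criticalDist_le hr)

theorem CritConfig.le_sendovRadius {n : ℕ} (hn : n ≠ 0) {β : ℂ} {z ζ : Fin n → ℂ} {ρ : ℝ}
    (h : CritConfig n β z ζ) (hβ : ‖β‖ ≤ 1) (hz : ∀ j, ‖z j‖ ≤ 1)
    (hρ : ∀ j, ρ ≤ ‖β - ζ j‖) : ρ ≤ sendovRadius (n + 1) β := by
  refine le_trans ?_ (le_csSup (bddAbove_criticalDist hn hβ) ⟨_, mem_sendovClass hβ hz, rfl⟩)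
  simp only [criticalDist]
  rw [h.setOf_isRoot, Metric.le_infDist (Set.range_nonempty_iff_nonempty.2 ⟨⟨0, Nat.pos_of_ne_zero hn⟩⟩)]
  rintro _ ⟨j, rfl⟩
  rw [dist_eq_norm]
  exact hρ j

theorem sendovRadius_le {n : ℕ} {β : ℂ} (hβ : ‖β‖ ≤ 1) {B : ℝ}
    (hB : ∀ P ∈ sendovClass (n + 1) β, criticalDist P β ≤ B) : sendovRadius (n + 1) β ≤ B := by
  refine csSup_le ?_ ?_
  · exact ⟨_, _, mem_sendovClass (z := fun _ : Fin n => 0) hβ (by simp), rfl⟩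
  · rintro _ ⟨P, hP, rfl⟩
    exact hB P hP

theorem norm_one_sub_le {ε : ℝ} (h0 : 0 ≤ ε) (h1 : ε ≤ 1) : ‖((1 - ε : ℝ) : ℂ)‖ ≤ 1 := by
  rw [Complex.norm_real, Real.norm_eq_abs, abs_le]
  constructor <;> linarith

theorem sendovRadius_lower {n : ℕ} (hn : 2 ≤ n) : ∃ C, ∀ᶠ ε in 𝓝[≥] (0 : ℝ),
    1 - (1 - lpValue n / n) * ε - C * ε ^ 2 ≤ sendovRadius (n + 1) ((1 - ε : ℝ) : ℂ) := by
  obtain ⟨C, hC0, hC⟩ := lower_configurations hn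
  have hsmall : ∀ᶠ ε in 𝓝[≥] (0 : ℝ), ε < 1 / (1 + C) :=
    nhdsWithin_le_nhds (Iio_mem_nhds (by positivity))
  refine ⟨lpValue n / n * C, ?_⟩
  filter_upwards [hC, hsmall, self_mem_nhdsWithin] with ε h hs h0
  have h0 : 0 ≤ ε := h0
  rw [lt_div_iff₀ (by linarith)] at hs
  have hCε : 0 ≤ C * ε := by positivity
  -- The largest scale `s` that leaves the slack `C ε²`.
  obtain ⟨z, ζ, hcfg, hz, hζ⟩ := h (ε - C * ε ^ 2) (by nlinarith) (by nlinarith) (by linarith)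
  refine le_trans (le_of_eq ?_)
    (hcfg.le_sendovRadius (by omega) (norm_one_sub_le h0 (by nlinarith)) hz hζ)
  ring

theorem sendovRadius_upper {n : ℕ} (hn : 2 ≤ n) : ∃ C, ∀ᶠ ε in 𝓝[≥] (0 : ℝ),
    sendovRadius (n + 1) ((1 - ε : ℝ) : ℂ) ≤ 1 - (1 - lpValue n / n) * ε + C * ε ^ 2 := by
  -- All competitors at once form one family, filtered by `ε → 0`; a bound along this filter is
  -- uniform over polynomials.
  let ι := {p : ℝ × ℝ × (Fin n → ℂ) × (Fin n → ℂ) // 0 ≤ p.1 ∧ 1 - p.1 ≤ p.2.1 ∧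
    CritConfig n ((1 - p.1 : ℝ) : ℂ) p.2.2.1 p.2.2.2 ∧ (∀ j, ‖p.2.2.1 j‖ ≤ 1) ∧
    ∀ j, p.2.1 ≤ ‖((1 - p.1 : ℝ) : ℂ) - p.2.2.2 j‖}
  let ε : ι → ℝ := fun p => p.1.1
  let l : Filter ι := comap ε (𝓝 0)
  let r : ι → ℝ := fun i => Real.sqrt (ε i)
  have hr2 : ∀ i, r i ^ 2 = ε i := fun i => Real.sq_sqrt i.2.1
  have hr : Tendsto r l (𝓝 0) := by
    have := (Real.continuous_sqrt.tendsto 0).comp (tendsto_comap : Tendsto ε l (𝓝 0))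
    rwa [Real.sqrt_zero] at this
  obtain ⟨C, hC⟩ := upper_asymptotics (l := l) (r := r) (z := fun i => i.1.2.2.1)
    (ζ := fun i => i.1.2.2.2) (ρ := fun i => i.1.2.1) hn hr
    (fun i => by rw [hr2]; exact i.2.2.2.1) (fun i => i.2.2.2.2.1)
    (fun i => by rw [hr2]; exact i.2.2.1) (fun i j => by rw [hr2]; exact i.2.2.2.2.2 j)
  have hL0 : 0 ≤ lpValue n / n := div_nonneg (lpValue_nonneg hn) (Nat.cast_nonneg n)
  rw [eventually_comap] at hC
  refine ⟨max C 0, ?_⟩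
  filter_upwards [nhdsWithin_le_nhds hC, nhdsWithin_le_nhds (Iic_mem_nhds one_pos),
    self_mem_nhdsWithin] with e he he1 he0
  have he0 : 0 ≤ e := he0
  refine sendovRadius_le (norm_one_sub_le he0 he1) fun P hP => ?_
  obtain ⟨z, ζ, hcfg, hz, hset⟩ := exists_critConfig hP
  have hmax : C * e ^ 2 ≤ max C 0 * e ^ 2 :=
    mul_le_mul_of_nonneg_right (le_max_left _ _) (sq_nonneg _)
  rcases le_total (1 - e) (criticalDist P ((1 - e : ℝ) : ℂ)) with hle | hle
  · let i : ι := ⟨(e, _, z, ζ), he0, hle, hcfg, hz, criticalDist_le hset⟩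
    have h1 := he i rfl
    have e4 : r i ^ 4 = (r i ^ 2) ^ 2 := by ring
    rw [e4, show r i ^ 2 = e from hr2 i] at h1
    exact h1.trans (by linarith)
  -- A critical point within `1 - ε` is harmless because `lpValue n ≥ 0`; `max C 0` keeps the error
  -- term nonnegative.
  · have : 0 ≤ max C 0 * e ^ 2 := by positivity
    nlinarith

/-- The linear program divides by `n - 1`, so degree two is separate: the critical point is the
midpoint of the roots, farthest from `β` when the other root is `-1`. -/
theorem sendovRadius_two {ε : ℝ} (h0 : 0 ≤ ε) (h1 : ε ≤ 1) :
    sendovRadius 2 ((1 - ε : ℝ) : ℂ) = 1 - 1 / 2 * ε := by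
  have hβ := norm_one_sub_le h0 h1
  apply le_antisymm
  · refine sendovRadius_le (n := 1) hβ fun P hP => ?_
    obtain ⟨z, ζ, hcfg, hz, hset⟩ := exists_critConfig hP
    refine (criticalDist_le hset 0).trans ?_
    have h := congrArg norm hcfg.prod_eq
    simp only [Fin.prod_univ_one, norm_mul] at h
    have h2 : ‖((1 : ℕ) : ℂ) + 1‖ = 2 := by norm_num
    rw [h2] at h
    have h3 : ‖((1 - ε : ℝ) : ℂ) - z 0‖ ≤ 1 - ε + 1 := by
      refine (norm_sub_le _ _).trans (add_le_add ?_ (hz 0))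
      rw [Complex.norm_real, Real.norm_of_nonneg (by linarith)]
    linarith
  · have hcfg : CritConfig 1 ((1 - ε : ℝ) : ℂ) (fun _ => -1) (fun _ => ((-ε / 2 : ℝ) : ℂ)) := by
      have e : ((-ε / 2 : ℝ) : ℂ) = (((1 - ε : ℝ) : ℂ) - 1) / 2 := by push_cast; ring
      rw [CritConfig, e]
      simp only [Fin.prod_univ_one, derivative_mul, derivative_X_sub_C, one_mul, mul_one]
      set b := ((1 - ε : ℝ) : ℂ)
      have : ((1 : ℕ) : ℂ) + 1 = 2 := by norm_num
      rw [this, mul_sub, ← C_mul, mul_div_cancel₀ _ (two_ne_zero), C_sub, C_neg, C_1]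
      rw [show (C (2 : ℂ) : ℂ[X]) = 2 from rfl]
      ring
    refine hcfg.le_sendovRadius one_ne_zero hβ (by simp) fun _ => ?_
    rw [← Complex.ofReal_sub, Complex.norm_real]
    exact le_trans (by linarith) (le_abs_self _)

/-- The coefficient of the linear term of the Sendov radius. -/
noncomputable def sendovSlope (n : ℕ) : ℝ := if n = 1 then 1 / 2 else 1 - lpValue n / n

theorem sendovSlope_of_two_le {n : ℕ} (hn : 2 ≤ n) : sendovSlope n = 1 - lpValue n / n :=
  if_neg (by omega)

theorem sendovSlope_pos {n : ℕ} (hn : 1 ≤ n) : 0 < sendovSlope n := by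
  rcases hn.eq_or_lt with rfl | hn
  · simp [sendovSlope]
  · rw [sendovSlope_of_two_le hn, sub_pos, div_lt_one (by positivity)]
    exact lpValue_lt hn

theorem tendsto_sendovSlope : Tendsto sendovSlope atTop (𝓝 (1 / 3)) := by
  have := tendsto_lpValue_div.const_sub 1
  norm_num at this
  refine this.congr' ?_
  filter_upwards [eventually_ge_atTop 2] with n hn using (sendovSlope_of_two_le hn).symm

theorem sendovRadius_sub_isBigO {n : ℕ} (hn : 1 ≤ n) :
    (fun ε : ℝ => sendovRadius (n + 1) ((1 - ε : ℝ) : ℂ) - (1 - sendovSlope n * ε))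
      =O[𝓝[≥] (0 : ℝ)] (fun ε => ε ^ 2) := by
  rcases hn.eq_or_lt with rfl | hn
  · refine IsBigO.of_bound 0 ?_
    filter_upwards [self_mem_nhdsWithin, nhdsWithin_le_nhds (Iic_mem_nhds one_pos)] with ε h0 h1
    rw [sendovRadius_two h0 h1]
    simp [sendovSlope]
  · obtain ⟨C, hC⟩ := sendovRadius_lower hn
    obtain ⟨C', hC'⟩ := sendovRadius_upper hn
    refine IsBigO.of_bound (max C C') ?_
    filter_upwards [hC, hC'] with ε h h'
    have h1 : C * ε ^ 2 ≤ max C C' * ε ^ 2 :=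
      mul_le_mul_of_nonneg_right (le_max_left _ _) (sq_nonneg _)
    have h2 : C' * ε ^ 2 ≤ max C C' * ε ^ 2 :=
      mul_le_mul_of_nonneg_right (le_max_right _ _) (sq_nonneg _)
    rw [sendovSlope_of_two_le hn, Real.norm_eq_abs, Real.norm_eq_abs,
      abs_of_nonneg (sq_nonneg ε), abs_le]
    constructor <;> linarith

/-! ### Conclusion -/

theorem tendsto_one_sub_nhdsLE : Tendsto (fun β : ℝ => 1 - β) (𝓝[≤] 1) (𝓝[≥] 0) := by
  refine tendsto_nhdsWithin_iff.2 ⟨?_, ?_⟩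
  · have : Tendsto (fun β : ℝ => 1 - β) (𝓝 1) (𝓝 (1 - 1)) := by
      exact (continuous_const.sub continuous_id).tendsto 1
    rw [sub_self] at this
    exact this.mono_left nhdsWithin_le_nhds
  · filter_upwards [self_mem_nhdsWithin] with β hβ
    exact sub_nonneg.2 (Set.mem_Iic.1 hβ)

theorem corollary3 :
    (∃ K : ℕ → ℝ,
      (∀ n : ℕ, 1 ≤ n → 0 < K n) ∧
      Tendsto K atTop (𝓝 (1 / 3)) ∧
      ∀ n : ℕ, 1 ≤ n →
        (fun β : ℝ => sendovRadius (n + 1) (β : ℂ) - (1 - K n * (1 - β)))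
          =O[𝓝[≤] (1 : ℝ)] (fun β : ℝ => (1 - β) ^ 2)) ∧
    (∀ c : ℝ, 1 / 3 < c → ∀ᶠ n : ℕ in atTop, ∀ᶠ β : ℝ in 𝓝[<] (1 : ℝ),
      1 - c * (1 - β) < sendovRadius (n + 1) (β : ℂ)) := by
  have hO : ∀ n : ℕ, 1 ≤ n →
      (fun β : ℝ => sendovRadius (n + 1) (β : ℂ) - (1 - sendovSlope n * (1 - β)))
        =O[𝓝[≤] (1 : ℝ)] (fun β : ℝ => (1 - β) ^ 2) := by
    intro n hn
    have := (sendovRadius_sub_isBigO hn).comp_tendsto tendsto_one_sub_nhdsLE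
    refine this.congr_left fun β => ?_
    simp only [Function.comp_apply, sub_sub_cancel]
  refine ⟨⟨sendovSlope, fun n => sendovSlope_pos, tendsto_sendovSlope, hO⟩, fun c hc => ?_⟩
  filter_upwards [tendsto_sendovSlope.eventually_lt_const hc, eventually_ge_atTop 1] with n hn hn1
  obtain ⟨C, hC⟩ := (hO n hn1).bound
  have hC' := hC.filter_mono (nhdsWithin_mono (1 : ℝ) Set.Iio_subset_Iic_self)
  have hlim : Tendsto (fun β : ℝ => C * (1 - β)) (𝓝[<] 1) (𝓝 0) := by
    have : Tendsto (fun β : ℝ => C * (1 - β)) (𝓝 1) (𝓝 (C * (1 - 1))) :=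
      (continuous_const.mul (continuous_const.sub continuous_id)).tendsto 1
    rw [sub_self, mul_zero] at this
    exact this.mono_left nhdsWithin_le_nhds
  -- Near `1` the error `C (1 - β)²` is smaller than the gap `(c - K_n)(1 - β)`; strictness needs `β
  -- < 1`.
  filter_upwards [hC', hlim.eventually_lt_const (sub_pos.2 hn), self_mem_nhdsWithin] with β h1 h2 h3
  have h3 : 0 < 1 - β := sub_pos.2 h3
  rw [Real.norm_eq_abs, Real.norm_eq_abs, abs_of_nonneg (sq_nonneg (1 - β))] at h1
  have h4 := neg_le_of_abs_le h1
  have h5 := mul_lt_mul_of_pos_right h2 h3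
  linarith
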